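/- For a finite point set $P$ in $\mathbb R^2$ or $\mathbb R^3$, a line is *spanned* by $P$ if it contains at least two points of $P$, and is an *ordinary line* of $P$ if it contains exactly two points of $P$. Call a pair of real numbers $(\beta,\gamma)$ with $\beta,\gamma>0$ a *pair of Beck constants* if every finite set of $n$ points in $\mathbb R^2$ with at most $\beta n$ points on any line spans at least $\gamma n^2$ lines. **Proposition 3.1.** There exist absolute constants $\alpha_0>0$ and $c_{\alpha_0}>0$ such that the following holds: if $P$ is a set of $n$ points in $\mathbb R^3$ with at most $\alpha_0 n$ points on any plane, then $P$ spans at least $c_{\alpha_0}n^2$ ordinary lines. More precisely, pairs of Beck constants exist, and for every pair $(\beta,\gamma)$ of Beck constants the above property holds with $\alpha_0=\beta\gamma$ and $c_{\alpha_0}=\gamma^5/2$. -/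

import Mathlib

/-- A line: an affine subspace of dimension one (automatically nonempty). -/
def IsLine {E : Type*} [AddCommGroup E] [Module ℝ E] (L : AffineSubspace ℝ E) : Prop :=
  Module.finrank ℝ L.direction = 1

/-- A plane: an affine subspace of dimension two (automatically nonempty). -/
def IsPlane {E : Type*} [AddCommGroup E] [Module ℝ E] (S : AffineSubspace ℝ E) : Prop :=
  Module.finrank ℝ S.direction = 2

/-- The lines spanned by `P`: those containing at least two points of `P`. -/
def spannedLines {E : Type*} [AddCommGroup E] [Module ℝ E] (P : Finset E) :
    Set (AffineSubspace ℝ E) :=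
  {L | IsLine L ∧ 2 ≤ ((P : Set E) ∩ (L : Set E)).ncard}

/-- The ordinary lines of `P`: those containing exactly two points of `P`. -/
def ordinaryLines {E : Type*} [AddCommGroup E] [Module ℝ E] (P : Finset E) :
    Set (AffineSubspace ℝ E) :=
  {L | IsLine L ∧ ((P : Set E) ∩ (L : Set E)).ncard = 2}

/-- `(β, γ)` is a pair of Beck constants: both are positive, and every set of `n` points in the
real plane with at most `β n` points on any line spans at least `γ n²` lines. -/
def IsBeckPair (β γ : ℝ) : Prop :=
  0 < β ∧ 0 < γ ∧
    ∀ P : Finset (EuclideanSpace ℝ (Fin 2)),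
      (∀ L : AffineSubspace ℝ (EuclideanSpace ℝ (Fin 2)), IsLine L →
        (((P : Set (EuclideanSpace ℝ (Fin 2))) ∩ (L : Set (EuclideanSpace ℝ (Fin 2)))).ncard : ℝ)
          ≤ β * (P.card : ℝ)) →
      γ * (P.card : ℝ) ^ 2 ≤ ((spannedLines P).ncard : ℝ)

/-- Every set of `n` points in `ℝ³` with at most `α n` points on any plane
spans at least `c n²` ordinary lines. -/
def FewCoplanarBound (α c : ℝ) : Prop :=
  ∀ P : Finset (EuclideanSpace ℝ (Fin 3)),
    (∀ S : AffineSubspace ℝ (EuclideanSpace ℝ (Fin 3)), IsPlane S →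
      (((P : Set (EuclideanSpace ℝ (Fin 3))) ∩ (S : Set (EuclideanSpace ℝ (Fin 3)))).ncard : ℝ)
        ≤ α * (P.card : ℝ)) →
    c * (P.card : ℝ) ^ 2 ≤ ((ordinaryLines P).ncard : ℝ)

/-! ### Lines and planes as spans of points. -/

section Lines

variable {E : Type*} [AddCommGroup E] [Module ℝ E]

/-! Incidences between the `n` points of `P` and the planes spanned by `P` are counted in two ways.
Let `(β, γ)` be Beck constants. A generic linear projection to the plane is injective on `P`, and
lines pull back to planes, so Beck's property gives `γ n²` spanned lines. These have at least `2 γ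
n²` incidences with `P`, at most `n` at each point, so at least `γ n` points lie on at least `γ n`
spanned lines each. Central projection from such a point `p` turns the lines through `p` into at
least `γ n` points and planes through `p` into lines. No line then carries more than `β (γ n)` image
points, so Beck's property applies again and `p` lies on at least `γ³ n²` spanned planes. In total
there are at least `γ⁴ n³` incidences.

For the upper bound, Sylvester–Gallai (Kelly's proof) puts an ordinary line in every spanned plane,
while the planes through one ordinary line have at most `3 n` incidences. Hence there are at least
`γ⁴ n² / 3` ordinary lines, and `γ ≤ 1/2` turns this into `γ⁵ n² / 2`.

Beck constants exist because a weak Szemerédi–Trotter bound already makes the contribution of rich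
lines decay geometrically: lines with many points, but at most `n / 1000`, account for at most `n² /
4` of the pairs, and the remaining pairs need quadratically many lines. The weak bound comes from
dividing the plane into vertical slabs with few crossings and bands of levels of the arrangement,
and applying Cauchy–Schwarz in each cell. -/

theorem isLine_affineSpan_pair {p q : E} (h : p ≠ q) : IsLine line[ℝ, p, q] := by
  rw [IsLine, direction_affineSpan, vectorSpan_pair_rev]
  exact finrank_span_singleton (by simpa [sub_eq_zero] using h.symm)

theorem IsLine.eq_affineSpan_pair {L : AffineSubspace ℝ E} (hL : IsLine L) {p q : E}
    (hp : p ∈ L) (hq : q ∈ L) (h : p ≠ q) : L = line[ℝ, p, q] := by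
  have hle : line[ℝ, p, q] ≤ L := affineSpan_pair_le_of_mem_of_mem hp hq
  have : Module.Finite ℝ L.direction := Module.finite_of_finrank_pos (by rw [hL]; norm_num)
  refine (AffineSubspace.eq_of_direction_eq_of_nonempty_of_le ?_
    ⟨p, left_mem_affineSpan_pair ℝ p q⟩ hle).symm
  refine Submodule.eq_of_le_of_finrank_eq (AffineSubspace.direction_le hle) ?_
  rw [hL]; exact isLine_affineSpan_pair h

theorem IsLine.eq_of_mem {L L' : AffineSubspace ℝ E} (hL : IsLine L) (hL' : IsLine L') {p q : E}
    (h : p ≠ q) (hp : p ∈ L) (hq : q ∈ L) (hp' : p ∈ L') (hq' : q ∈ L') : L = L' := by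
  rw [hL.eq_affineSpan_pair hp hq h, hL'.eq_affineSpan_pair hp' hq' h]

theorem isPlane_affineSpan_triple {p q r : E} (hpq : p ≠ q) (hr : r ∉ line[ℝ, p, q]) :
    IsPlane (affineSpan ℝ {p, q, r}) := by
  have hi : AffineIndependent ℝ ![p, q, r] := affineIndependent_of_ne_of_mem_of_mem_of_notMem
    (s := line[ℝ, p, q]) hpq (left_mem_affineSpan_pair ..) (right_mem_affineSpan_pair ..) hr
  rw [IsPlane, direction_affineSpan]
  have := hi.finrank_vectorSpan (n := 2) (by simp)
  rwa [Matrix.range_cons, Matrix.range_cons, Matrix.range_cons, Matrix.range_empty,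
    Set.union_empty, Set.singleton_union, Set.singleton_union] at this

theorem IsPlane.eq_affineSpan_triple {S : AffineSubspace ℝ E} (hS : IsPlane S) {p q r : E}
    (hp : p ∈ S) (hq : q ∈ S) (hr : r ∈ S) (hpq : p ≠ q) (hrl : r ∉ line[ℝ, p, q]) :
    S = affineSpan ℝ {p, q, r} := by
  have hle : affineSpan ℝ {p, q, r} ≤ S := affineSpan_le.2 (by
    rintro x (rfl | rfl | rfl) <;> assumption)
  have : Module.Finite ℝ S.direction := Module.finite_of_finrank_pos (by rw [hS]; norm_num)
  refine (AffineSubspace.eq_of_direction_eq_of_nonempty_of_le ?_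
    ⟨p, mem_affineSpan ℝ (by simp)⟩ hle).symm
  refine Submodule.eq_of_le_of_finrank_eq (AffineSubspace.direction_le hle) ?_
  rw [hS]; exact isPlane_affineSpan_triple hpq hrl

/-- The finite set of lines joining two distinct points of `P`. -/
noncomputable def lineFinset (P : Finset E) : Finset (AffineSubspace ℝ E) :=
  open Classical in P.offDiag.image fun x => line[ℝ, x.1, x.2]

theorem mem_lineFinset {P : Finset E} {L : AffineSubspace ℝ E} :
    L ∈ lineFinset P ↔ ∃ p ∈ P, ∃ q ∈ P, p ≠ q ∧ L = line[ℝ, p, q] := by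
  classical
  simp only [lineFinset, Finset.mem_image, Finset.mem_offDiag, Prod.exists]
  constructor
  · rintro ⟨p, q, ⟨hp, hq, h⟩, rfl⟩
    exact ⟨p, hp, q, hq, h, rfl⟩
  · rintro ⟨p, hp, q, hq, h, rfl⟩
    exact ⟨p, q, ⟨hp, hq, h⟩, rfl⟩

theorem isLine_of_mem_lineFinset {P : Finset E} {L : AffineSubspace ℝ E} (h : L ∈ lineFinset P) :
    IsLine L := by
  obtain ⟨p, -, q, -, hne, rfl⟩ := mem_lineFinset.1 h
  exact isLine_affineSpan_pair hne

open Classical in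
theorem ncard_inter_eq_card_filter (P : Finset E) (S : AffineSubspace ℝ E) :
    ((P : Set E) ∩ (S : Set E)).ncard = (P.filter (· ∈ S)).card := by
  rw [← Set.ncard_coe_finset]
  congr 1
  ext x
  simp

theorem coe_lineFinset (P : Finset E) : (lineFinset P : Set (AffineSubspace ℝ E)) =
    spannedLines P := by
  classical
  ext L
  rw [Finset.mem_coe, mem_lineFinset, spannedLines, Set.mem_ofPred_eq, ncard_inter_eq_card_filter]
  constructor
  · rintro ⟨p, hp, q, hq, h, rfl⟩
    refine ⟨isLine_affineSpan_pair h, Finset.one_lt_card.2 ⟨p, ?_, q, ?_, h⟩⟩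
    · simp [hp, left_mem_affineSpan_pair]
    · simp [hq, right_mem_affineSpan_pair]
  · rintro ⟨hL, h2⟩
    obtain ⟨p, hp, q, hq, h⟩ := Finset.one_lt_card.1 h2
    simp only [Finset.mem_filter] at hp hq
    exact ⟨p, hp.1, q, hq.1, h, hL.eq_affineSpan_pair hp.2 hq.2 h⟩

theorem ncard_spannedLines (P : Finset E) : (spannedLines P).ncard = (lineFinset P).card := by
  rw [← coe_lineFinset, Set.ncard_coe_finset]

theorem ordinaryLines_subset_lineFinset (P : Finset E) :
    ordinaryLines P ⊆ (lineFinset P : Set (AffineSubspace ℝ E)) := by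
  rw [coe_lineFinset]
  exact fun L hL => ⟨hL.1, hL.2.ge⟩

theorem two_mul_card_lineFinset_le (P : Finset E) :
    2 * (lineFinset P).card ≤ P.card * (P.card - 1) := by
  classical
  have h : ∀ L ∈ lineFinset P, 2 ≤ (P.offDiag.filter fun x => line[ℝ, x.1, x.2] = L).card := by
    intro L hL
    obtain ⟨p, hp, q, hq, hne, rfl⟩ := mem_lineFinset.1 hL
    refine Finset.one_lt_card.2 ⟨(p, q), ?_, (q, p), ?_, fun h => hne (congrArg Prod.fst h)⟩
    · simp [hp, hq, hne]
    · simp [hp, hq, hne.symm, Set.pair_comm]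
  have h' := Finset.mul_card_image_le_card_of_maps_to (s := P.offDiag)
    (fun x hx => mem_lineFinset.2 ⟨x.1, (Finset.mem_offDiag.1 hx).1, x.2,
      (Finset.mem_offDiag.1 hx).2.1, (Finset.mem_offDiag.1 hx).2.2, rfl⟩) 2 h
  rw [Finset.offDiag_card] at h'
  rw [Nat.mul_sub_one]
  exact h'

end Lines

/-! ### Linear equations of hyperplanes. -/

section Hyperplanes

variable {E : Type*} [AddCommGroup E] [Module ℝ E] [Module.Finite ℝ E]

theorem finrank_ker_add_one {φ : E →ₗ[ℝ] ℝ} (hφ : φ ≠ 0) :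
    Module.finrank ℝ (LinearMap.ker φ) + 1 = Module.finrank ℝ E :=
  Module.Dual.finrank_ker_add_one_of_ne_zero hφ

theorem IsLine.exists_equation {L : AffineSubspace ℝ E} (hL : IsLine L)
    (hE : Module.finrank ℝ E = 2) :
    ∃ (φ : E →ₗ[ℝ] ℝ) (c : ℝ), φ ≠ 0 ∧ ∀ x, x ∈ L ↔ φ x = c := by
  have hlt : L.direction < ⊤ := lt_top_iff_ne_top.2 fun h => by
    have := hL
    rw [IsLine, h, finrank_top, hE] at this
    norm_num at this
  obtain ⟨φ, hφ, hle⟩ := Submodule.exists_le_ker_of_lt_top _ hlt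
  have hker : L.direction = LinearMap.ker φ := by
    refine Submodule.eq_of_le_of_finrank_eq hle ?_
    have := finrank_ker_add_one hφ
    rw [hL]; omega
  have hne : (L : Set E).Nonempty := by
    rw [AffineSubspace.nonempty_iff_ne_bot]
    rintro rfl
    rw [IsLine, AffineSubspace.direction_bot, finrank_bot] at hL
    norm_num at hL
  obtain ⟨p, hp⟩ := hne
  refine ⟨φ, φ p, hφ, fun x => ?_⟩
  rw [← AffineSubspace.vsub_right_mem_direction_iff_mem hp, hker, LinearMap.mem_ker, vsub_eq_sub,
    map_sub, sub_eq_zero]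

theorem exists_isPlane_of_equation (hE : Module.finrank ℝ E = 3) {φ : E →ₗ[ℝ] ℝ} (hφ : φ ≠ 0)
    (c : ℝ) : ∃ S : AffineSubspace ℝ E, IsPlane S ∧ ∀ x, x ∈ S ↔ φ x = c := by
  obtain ⟨p, rfl⟩ := LinearMap.surjective hφ c
  refine ⟨AffineSubspace.mk' p (LinearMap.ker φ), ?_, fun x => ?_⟩
  · have := finrank_ker_add_one hφ
    rw [IsPlane, AffineSubspace.direction_mk']
    omega
  · rw [AffineSubspace.mem_mk', LinearMap.mem_ker, vsub_eq_sub, map_sub, sub_eq_zero]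

end Hyperplanes

/-- The differences of distinct points are finitely many nonzero vectors, and some functional
vanishes at none of them. -/
theorem exists_dual_injOn {E : Type*} [AddCommGroup E] [Module ℝ E] [Module.Finite ℝ E]
    (P : Finset E) : ∃ f : E →ₗ[ℝ] ℝ, Set.InjOn f P := by
  classical
  obtain ⟨f, hf⟩ := Module.exists_dual_forall_apply_ne_zero (K := ℝ)
    (fun x : P.offDiag => x.1.1 - x.1.2)
    (fun x => sub_ne_zero.2 (Finset.mem_offDiag.1 x.2).2.2)
  refine ⟨f, fun p hp q hq h => by_contra fun hne =>
    hf ⟨(p, q), Finset.mem_offDiag.2 ⟨hp, hq, hne⟩⟩ ?_⟩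
  simp [h]

/-! ### Elementary incidence bounds. -/

section Incidences

open Classical in
/-- Cauchy–Schwarz bound for incidences when two elements of `T` have at most one common
neighbour in `S`. -/
theorem sq_sum_card_filter_le {α β : Type*} (S : Finset α) (T : Finset β) (R : α → β → Prop)
    (h : ∀ t ∈ T, ∀ t' ∈ T, t ≠ t' → ∀ s ∈ S, ∀ s' ∈ S,
      R s t → R s t' → R s' t → R s' t' → s = s') :
    (∑ s ∈ S, (T.filter (R s)).card) ^ 2 ≤
      S.card * (∑ s ∈ S, (T.filter (R s)).card + T.card ^ 2) := by
  refine sq_sum_le_card_mul_sum_sq.trans (Nat.mul_le_mul_left _ ?_)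
  -- The square of a degree counts ordered pairs of neighbours, split here into diagonal and
  -- off-diagonal pairs. By `h`, each off-diagonal pair is counted for at most one `s`.
  have hsq : ∀ s, (T.filter (R s)).card ^ 2 =
      (T.filter (R s)).card + (T.offDiag.filter fun x => R s x.1 ∧ R s x.2).card := by
    intro s
    have : (T.offDiag.filter fun x => R s x.1 ∧ R s x.2) = (T.filter (R s)).offDiag := by
      ext x
      simp only [Finset.mem_filter, Finset.mem_offDiag]
      tauto
    rw [this, Finset.offDiag_card, sq]
    have := Nat.le_mul_self (T.filter (R s)).card
    omega
  have hoff : ∑ s ∈ S, (T.offDiag.filter fun x => R s x.1 ∧ R s x.2).card ≤ T.offDiag.card := by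
    rw [Finset.card_eq_sum_ones]
    refine (Finset.sum_card_bipartiteAbove_eq_sum_card_bipartiteBelow
      (fun s (x : β × β) => R s x.1 ∧ R s x.2)).trans_le (Finset.sum_le_sum fun x hx => ?_)
    rw [Finset.mem_offDiag] at hx
    refine Finset.card_le_one.2 fun s hs s' hs' => ?_
    simp only [Finset.mem_bipartiteBelow] at hs hs'
    exact h x.1 hx.1 x.2 hx.2.1 hx.2.2 s hs.1 s' hs'.1 hs.2.1 hs.2.2 hs'.2.1 hs'.2.2
  simp only [hsq, Finset.sum_add_distrib]
  refine Nat.add_le_add_left (hoff.trans ?_) _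
  rw [Finset.offDiag_card, sq]
  exact Nat.sub_le _ _

open Classical in
/-- Trivial bound for the number of rich lines: few lines are richer than `√(2n)`. -/
theorem mul_card_le_two_mul_of_sq_lt {α β : Type*} (A : Finset α) (P : Finset β)
    (R : α → β → Prop)
    (h : ∀ l ∈ A, ∀ l' ∈ A, l ≠ l' → ∀ p ∈ P, ∀ p' ∈ P,
      R l p → R l' p → R l p' → R l' p' → p = p')
    (k : ℕ) (hk : ∀ l ∈ A, k ≤ (P.filter (R l)).card) (hkn : 2 * P.card < k ^ 2) :
    k * A.card ≤ 2 * P.card := by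
  have h1 := sq_sum_card_filter_le P A (fun p l => R l p) h
  have h2 : ∑ p ∈ P, (A.filter fun l => R l p).card = ∑ l ∈ A, (P.filter (R l)).card :=
    Finset.sum_card_bipartiteAbove_eq_sum_card_bipartiteBelow (fun p l => R l p)
  rw [h2] at h1
  have h3 : A.card * k ≤ ∑ l ∈ A, (P.filter (R l)).card :=
    Finset.card_nsmul_le_sum A _ k hk
  set I := ∑ l ∈ A, (P.filter (R l)).card
  -- If `k |A| > 2 |P|`, then `I > 2 |P|` absorbs the linear term of Cauchy–Schwarz and leaves `I² ≤
  -- 2 |P| |A|²`, against `I ≥ k |A|` and `k² > 2 |P|`.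
  by_contra! hlt
  have hI : 2 * P.card < I := by nlinarith
  have h4 : I ^ 2 ≤ 2 * P.card * A.card ^ 2 := by nlinarith
  have h5 : (A.card * k) ^ 2 ≤ I ^ 2 := Nat.pow_le_pow_left h3 2
  have hA : 0 < A.card := Nat.pos_of_ne_zero fun h0 => by simp [h0] at hlt
  have : A.card ^ 2 * (2 * P.card) < A.card ^ 2 * k ^ 2 :=
    Nat.mul_lt_mul_of_pos_left hkn (by positivity)
  nlinarith

open Classical in
/-- If at most `M` lines meet the point set `P`, there are at most `M + |P| √M` incidences. -/
theorem sum_card_filter_le_add_mul_sqrt {α β : Type*} (A : Finset α) (P : Finset β)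
    (R : α → β → Prop)
    (h : ∀ l ∈ A, ∀ l' ∈ A, l ≠ l' → ∀ p ∈ P, ∀ p' ∈ P,
      R l p → R l' p → R l p' → R l' p' → p = p')
    (M : ℕ) (hM : (A.filter fun l => ∃ p ∈ P, R l p).card ≤ M) :
    ((∑ l ∈ A, (P.filter (R l)).card : ℕ) : ℝ) ≤ M + P.card * √M := by
  set B := A.filter fun l => ∃ p ∈ P, R l p with hB
  have hsum : ∑ l ∈ A, (P.filter (R l)).card = ∑ l ∈ B, (P.filter (R l)).card := by
    symm
    refine Finset.sum_subset (Finset.filter_subset _ _) fun l hl hl' => ?_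
    rw [Finset.card_eq_zero, Finset.filter_eq_empty_iff]
    exact fun p hp hR => hl' (Finset.mem_filter.2 ⟨hl, p, hp, hR⟩)
  -- The dual form: two distinct points lie on at most one common line.
  have h1 := sq_sum_card_filter_le B P R fun p hp p' hp' hne l hl l' hl' h1 h2 h3 h4 =>
    by_contra fun hll => hne (h l (Finset.mem_filter.1 hl).1 l' (Finset.mem_filter.1 hl').1 hll
      p hp p' hp' h1 h3 h2 h4)
  rw [hsum]
  set I := ∑ l ∈ B, (P.filter (R l)).card
  have h2 : (I : ℝ) ^ 2 ≤ M * (I + (P.card : ℝ) ^ 2) := by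
    exact_mod_cast h1.trans (Nat.mul_le_mul_right _ hM)
  have hu : √(M : ℝ) ^ 2 = M := Real.sq_sqrt (Nat.cast_nonneg M)
  have hu0 := Real.sqrt_nonneg (M : ℝ)
  set u := √(M : ℝ)
  have hn : (0 : ℝ) ≤ P.card := Nat.cast_nonneg _
  rw [← hu] at h2 ⊢
  by_contra! hlt
  have h3 : (P.card : ℝ) * u < I - u ^ 2 := by linarith
  have h4 : 0 ≤ (P.card : ℝ) * u := by positivity
  have h5 : (P.card : ℝ) * u < I := by nlinarith [sq_nonneg u]
  have h6 : ((P.card : ℝ) * u) * (P.card * u) < I * (I - u ^ 2) :=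
    mul_lt_mul'' h5 h3 h4 h4
  nlinarith

end Incidences

/-! ### Slabs with few crossings and levels in an arrangement. -/

section Cutting

open Classical in
/-- Few cut points suffice to spread a finite family of reals evenly. -/
theorem exists_cut {ι : Type*} (f : ι → ℝ) (m s : ℕ) (S : Finset ι)
    (h : S.card ≤ (s + 1) * m) :
    ∃ Z : Finset ℝ, Z.card ≤ s ∧ ∀ I : Set ℝ, I.OrdConnected → (∀ z ∈ Z, z ∉ I) →
      (S.filter fun i => f i ∈ I).card ≤ m := by
  induction s generalizing S with
  | zero =>
    exact ⟨∅, le_rfl, fun I _ _ => (Finset.card_filter_le _ _).trans (by simpa using h)⟩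
  | succ s ih =>
    by_cases hS : S.card ≤ m
    · exact ⟨∅, by simp, fun I _ _ => (Finset.card_filter_le _ _).trans hS⟩
    push Not at hS
    -- Greedy choice: `z` is the largest value with at most `m` indices strictly below it. Values
    -- equal to `z` are not counted by any interval avoiding `z`, so ties do no harm, and more than
    -- `m` indices are removed before the induction.
    obtain ⟨z, hz, hz'⟩ : ∃ z, (S.filter fun i => f i < z).card ≤ m ∧
        m < (S.filter fun i => f i ≤ z).card := by
      set T := (S.image f).filter fun z => (S.filter fun i => f i < z).card ≤ m with hT
      have hne : (S.image f).Nonempty := (Finset.card_pos.1 (by omega)).image f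
      have hTne : T.Nonempty := by
        refine ⟨(S.image f).min' hne, Finset.mem_filter.2 ⟨Finset.min'_mem _ _, ?_⟩⟩
        rw [Finset.filter_eq_empty_iff.2, Finset.card_empty]
        · exact Nat.zero_le _
        · exact fun i hi => not_lt.2 (Finset.min'_le _ _ (Finset.mem_image_of_mem f hi))
      refine ⟨T.max' hTne, (Finset.mem_filter.1 (T.max'_mem hTne)).2, ?_⟩
      by_contra! hle
      set U := (S.image f).filter fun z => T.max' hTne < z
      rcases U.eq_empty_or_nonempty with hU | hU
      · refine absurd hle (not_le.2 (hS.trans_eq ?_))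
        rw [Finset.filter_true_of_mem]
        intro i hi
        by_contra! hlt
        have : f i ∈ U := Finset.mem_filter.2 ⟨Finset.mem_image_of_mem f hi, hlt⟩
        simp [hU] at this
      · have hm := Finset.mem_filter.1 (U.min'_mem hU)
        refine absurd (T.le_max' (U.min' hU) (Finset.mem_filter.2 ⟨hm.1, ?_⟩)) (not_le.2 hm.2)
        refine (Finset.card_le_card fun i hi => ?_).trans hle
        rw [Finset.mem_filter] at hi ⊢
        refine ⟨hi.1, ?_⟩
        by_contra! hlt
        exact absurd (U.min'_le (f i) (Finset.mem_filter.2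
          ⟨Finset.mem_image_of_mem f hi.1, hlt⟩)) (not_le.2 hi.2)
    have hsplit := Finset.card_filter_add_card_filter_not (s := S) (fun i => f i ≤ z)
    obtain ⟨Z, hZ, hZI⟩ := ih (S.filter fun i => ¬ f i ≤ z) (by nlinarith)
    refine ⟨insert z Z, (Finset.card_insert_le _ _).trans (by omega), fun I hI hd => ?_⟩
    have hzI : z ∉ I := hd z (Finset.mem_insert_self _ _)
    by_cases hex : ∃ i ∈ S, f i ∈ I ∧ f i < z
    · obtain ⟨i, -, hiI, hiz⟩ := hex
      refine (Finset.card_le_card fun j hj => ?_).trans hz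
      rw [Finset.mem_filter] at hj ⊢
      refine ⟨hj.1, ?_⟩
      by_contra! hle
      exact hzI (hI.out hiI hj.2 ⟨hiz.le, hle⟩)
    · push Not at hex
      refine (Finset.card_le_card fun j hj => ?_).trans
        (hZI I hI fun y hy => hd y (Finset.mem_insert_of_mem hy))
      rw [Finset.mem_filter] at hj
      rw [Finset.mem_filter, Finset.mem_filter]
      refine ⟨⟨hj.1, fun hle => ?_⟩, hj.2⟩
      have hge := hex j hj.1 hj.2
      exact hzI (le_antisymm hge hle ▸ hj.2)

variable {ι : Type*} (a b : ι → ℝ) (A : Finset ι)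

open Classical in
/-- The number of lines `y = a l x + b l` of `A` strictly below the point `(x, y)`. -/
noncomputable def level (x y : ℝ) : ℕ := (A.filter fun l => a l * x + b l < y).card

/-- The ordered pairs of nonparallel lines of `A`. -/
noncomputable def crossingPairs : Finset (ι × ι) :=
  open Classical in (A ×ˢ A).filter fun x => a x.1 ≠ a x.2

/-- The abscissa of the crossing point of two nonparallel lines. -/
noncomputable def crossingAbscissa (x : ι × ι) : ℝ := (b x.2 - b x.1) / (a x.1 - a x.2)

variable {a b A}

theorem crossingAbscissa_mem_uIcc {l l' : ι} {x x' : ℝ}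
    (h : a l' * x + b l' < a l * x + b l) (h' : a l * x' + b l ≤ a l' * x' + b l') :
    a l ≠ a l' ∧ crossingAbscissa a b (l, l') ∈ Set.uIcc x x' := by
  have hne : a l ≠ a l' := fun h0 => by rw [h0] at h h'; linarith
  refine ⟨hne, ?_⟩
  rw [crossingAbscissa, Set.mem_uIcc]
  rcases lt_or_gt_of_ne hne with hlt | hgt
  · left
    rw [← neg_div_neg_eq, le_div_iff₀ (by linarith), div_le_iff₀ (by linarith)]
    constructor <;> nlinarith
  · right
    rw [le_div_iff₀ (by linarith), div_le_iff₀ (by linarith)]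
    constructor <;> nlinarith

open Classical in
-- A line that is below `l` at `x` but no longer at `x'` must cross `l` in between.
theorem level_le_level_add {I : Set ℝ} (hI : I.OrdConnected) {l : ι} (hl : l ∈ A) {x x' : ℝ}
    (hx : x ∈ I) (hx' : x' ∈ I) :
    level a b A x (a l * x + b l) ≤ level a b A x' (a l * x' + b l) +
      (A.filter fun l' => (l, l') ∈ crossingPairs a A ∧ crossingAbscissa a b (l, l') ∈ I).card := by
  refine (Finset.card_le_card fun l' hl' => ?_).trans (Finset.card_union_le _ _)
  rw [Finset.mem_filter] at hl'
  rw [Finset.mem_union, Finset.mem_filter, Finset.mem_filter]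
  by_cases hlt : a l' * x' + b l' < a l * x' + b l
  · exact Or.inl ⟨hl'.1, hlt⟩
  · obtain ⟨h1, h2⟩ := crossingAbscissa_mem_uIcc hl'.2 (not_lt.1 hlt)
    refine Or.inr ⟨hl'.1, ?_, hI.uIcc_subset hx hx' h2⟩
    simp [crossingPairs, hl, hl'.1, h1]

open Classical in
theorem level_injOn {x : ℝ} (hx : Set.InjOn (fun l => a l * x + b l) A) :
    Set.InjOn (fun l => level a b A x (a l * x + b l)) A := by
  have key : ∀ l ∈ A, ∀ l' ∈ A, a l * x + b l < a l' * x + b l' →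
      level a b A x (a l * x + b l) < level a b A x (a l' * x + b l') := by
    intro l hl l' hl' hlt
    refine Finset.card_lt_card (Finset.ssubset_iff_of_subset (fun i hi => ?_) |>.2
      ⟨l, by simp [hl, hlt], by simp⟩)
    rw [Finset.mem_filter] at hi ⊢
    exact ⟨hi.1, hi.2.trans hlt⟩
  intro l hl l' hl' h
  by_contra hne
  rcases lt_or_gt_of_ne (fun h0 => hne (hx hl hl' h0)) with hlt | hlt
  · exact (key l hl l' hl' hlt).ne h
  · exact (key l' hl' l hl hlt).ne' h

open Classical in
/-- A cell of the decomposition into slabs and bands of levels is met by few lines. -/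
theorem card_lines_meeting_cell_le {I : Set ℝ} (hI : I.OrdConnected) {w : ℕ} (hw : 0 < w)
    (hcross : ((crossingPairs a A).filter fun x => crossingAbscissa a b x ∈ I).card ≤ w ^ 2)
    {x₀ : ℝ} (hx₀ : x₀ ∈ I) (hinj : Set.InjOn (fun l => a l * x₀ + b l) A) (j : ℕ) :
    (A.filter fun l => ∃ x ∈ I, level a b A x (a l * x + b l) / w = j).card ≤ 4 * w := by
  set cr : ι → ℕ := fun l =>
    (A.filter fun l' => (l, l') ∈ crossingPairs a A ∧ crossingAbscissa a b (l, l') ∈ I).card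
    with hcr
  have hwild : (A.filter fun l => w ≤ cr l).card ≤ w := by
    have h1 : (A.filter fun l => w ≤ cr l).card * w ≤ ∑ l ∈ A.filter fun l => w ≤ cr l, cr l :=
      Finset.card_nsmul_le_sum _ _ _ fun l hl => (Finset.mem_filter.1 hl).2
    have h2 : ∑ l ∈ A.filter (fun l => w ≤ cr l), cr l ≤ ∑ l ∈ A, cr l :=
      Finset.sum_le_sum_of_subset (Finset.filter_subset _ _)
    have h3 : ∑ l ∈ A, cr l =
        ((crossingPairs a A).filter fun x => crossingAbscissa a b x ∈ I).card := by
      rw [hcr, ← Finset.card_sigma]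
      refine Finset.card_bij' (fun x _ => (x.1, x.2)) (fun x _ => ⟨x.1, x.2⟩) ?_ ?_ ?_ ?_
      · simp +contextual
      · simp +contextual [crossingPairs]
      · simp
      · simp
    have h4 : (A.filter fun l => w ≤ cr l).card * w ≤ w * w := by
      rw [← sq]; exact h1.trans (h2.trans (h3.trans_le hcross))
    exact Nat.le_of_mul_le_mul_right h4 hw
  -- A line with at most `w - 1` crossings over `I` changes level by at most `w - 1`, so its level
  -- at `x₀` lies in this window; there distinct lines have distinct levels. At most `w` lines have
  -- more crossings.
  have htame : (A.filter fun l => level a b A x₀ (a l * x₀ + b l) ∈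
      Finset.Ico (j * w + 1 - w) ((j + 2) * w)).card ≤ 3 * w := by
    have := Finset.card_le_card_of_injOn (s := A.filter fun l =>
      level a b A x₀ (a l * x₀ + b l) ∈ Finset.Ico (j * w + 1 - w) ((j + 2) * w))
      (fun l => level a b A x₀ (a l * x₀ + b l)) (fun l hl => (Finset.mem_filter.1 hl).2)
      ((level_injOn hinj).mono fun l hl => (Finset.mem_filter.1 hl).1)
    rw [Nat.card_Ico] at this
    have h2 : (j + 2) * w = j * w + 2 * w := add_mul _ _ _
    omega
  refine (Finset.card_le_card fun l hl => ?_).trans ((Finset.card_union_le _ _).trans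
    ((add_le_add hwild htame).trans (by omega)))
  obtain ⟨hlA, x, hxI, hxj⟩ := Finset.mem_filter.1 hl
  rw [Finset.mem_union, Finset.mem_filter, Finset.mem_filter]
  by_cases hc : w ≤ cr l
  · exact Or.inl ⟨hlA, hc⟩
  · refine Or.inr ⟨hlA, ?_⟩
    have h1 := level_le_level_add (a := a) (b := b) hI hlA hxI hx₀
    have h2 := level_le_level_add (a := a) (b := b) hI hlA hx₀ hxI
    have h3 : j * w ≤ level a b A x (a l * x + b l) := by
      rw [← hxj]; exact Nat.div_mul_le_self _ _
    have h4 : level a b A x (a l * x + b l) < (j + 1) * w := by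
      rw [← hxj]; exact Nat.lt_mul_of_div_lt (Nat.lt_succ_self _) hw
    rw [Finset.mem_Ico]
    rw [add_mul] at h4 ⊢
    change _ ≤ _ + cr l at h1
    change _ ≤ _ + cr l at h2
    omega

end Cutting

/-! ### A weak Szemerédi–Trotter bound. -/

section RichLines

theorem exists_gt_forall_notMem_Ioc (F : Finset ℝ) (x : ℝ) :
    ∃ y, x < y ∧ ∀ z ∈ F, z ≤ x ∨ y < z := by
  have h : ∀ᶠ y in nhdsWithin x (Set.Ioi x), ∀ z ∈ F, z ≤ x ∨ y < z := by
    refine (Filter.eventually_all_finset F).2 fun z _ => ?_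
    rcases le_or_gt z x with hz | hz
    · exact Filter.Eventually.of_forall fun _ => Or.inl hz
    · filter_upwards [Ioo_mem_nhdsGT hz] with y hy using Or.inr hy.2
  obtain ⟨y, hy, hxy⟩ := (h.and self_mem_nhdsWithin).exists
  exact ⟨y, hxy, hy⟩

open Classical in
/-- The open slab with index `i` cut out by the abscissae in `Z`. -/
def slab (Z : Finset ℝ) (i : ℕ) : Set ℝ := {x | x ∉ Z ∧ (Z.filter (· < x)).card = i}

theorem slab_ordConnected (Z : Finset ℝ) (i : ℕ) : (slab Z i).OrdConnected := by
  classical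
  refine ⟨fun x hx y hy u hu => ?_⟩
  have hmono : ∀ {s t : ℝ}, s ≤ t → (Z.filter (· < s)) ⊆ Z.filter (· < t) := fun hst z hz => by
    rw [Finset.mem_filter] at hz ⊢
    exact ⟨hz.1, hz.2.trans_le hst⟩
  have h1 := Finset.card_le_card (hmono hu.1)
  have h2 := Finset.card_le_card (hmono hu.2)
  have hx2 := hx.2
  have hy2 := hy.2
  refine ⟨fun huZ => ?_, by omega⟩
  have hlt : u < y := lt_of_le_of_ne hu.2 fun h => hy.1 (h ▸ huZ)
  have : (Z.filter (· < u)).card < (Z.filter (· < y)).card :=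
    Finset.card_lt_card ((Finset.ssubset_iff_of_subset (hmono hu.2)).2 ⟨u, by simp [huZ, hlt],
      by simp⟩)
  omega

theorem mem_slab_of_forall {Z : Finset ℝ} {i : ℕ} {x y : ℝ} (hx : x ∈ slab Z i) (hxy : x < y)
    (h : ∀ z ∈ Z, z ≤ x ∨ y < z) : y ∈ slab Z i := by
  classical
  refine ⟨fun hy => ?_, ?_⟩
  · rcases h y hy with h | h
    · exact absurd hxy (not_lt.2 h)
    · exact lt_irrefl _ h
  · rw [← hx.2]
    congr 1
    refine Finset.filter_congr fun z hz => ⟨fun hzy => ?_, fun hzx => hzx.trans hxy⟩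
    refine lt_of_le_of_ne ((h z hz).resolve_right (not_lt.2 hzy.le)) fun h0 => hx.1 (h0 ▸ hz)

variable {ι κ : Type*} {a b : ι → ℝ} {A : Finset ι} {x y : κ → ℝ} {P : Finset κ}

theorem eq_of_two_common_points (hab : ∀ l ∈ A, ∀ l' ∈ A, a l = a l' → b l = b l' → l = l')
    (hxy : ∀ p ∈ P, ∀ q ∈ P, x p = x q → y p = y q → p = q) :
    ∀ l ∈ A, ∀ l' ∈ A, l ≠ l' → ∀ p ∈ P, ∀ p' ∈ P, y p = a l * x p + b l →
      y p = a l' * x p + b l' → y p' = a l * x p' + b l → y p' = a l' * x p' + b l' → p = p' := by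
  intro l hl l' hl' hne p hp p' hp' h1 h2 h3 h4
  have h5 : (a l - a l') * (x p - x p') = 0 := by linear_combination h2 - h1 - h4 + h3
  rcases mul_eq_zero.1 h5 with h0 | h0
  · refine absurd (hab l hl l' hl' (by linarith) ?_) hne
    have : a l = a l' := by linarith
    rw [this] at h1
    linarith
  · have hx : x p = x p' := by linarith
    exact hxy p hp p' hp' hx (by rw [h1, h3, hx])

open Classical in
-- The at most `r² w²` crossings are cut into `r²` slabs with at most `w²` each, and the levels into
-- `r` bands of height `w`. Each of the `r³` cells meets at most `4 w` lines, so Cauchy–Schwarz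
-- bounds its incidences. Points on the cuts cost each line fewer than `r²` incidences.
theorem sum_card_incidences_le (hab : ∀ l ∈ A, ∀ l' ∈ A, a l = a l' → b l = b l' → l = l')
    (hxy : ∀ p ∈ P, ∀ q ∈ P, x p = x q → y p = y q → p = q) {r w : ℕ} (hr : 0 < r) (hw : 0 < w)
    (hrw : A.card ≤ r * w) :
    ((∑ l ∈ A, (P.filter fun p => y p = a l * x p + b l).card : ℕ) : ℝ) ≤
      4 * r ^ 3 * w + r ^ 2 * A.card + P.card * (2 * √w) := by
  have hr2 : r ^ 2 - 1 + 1 = r ^ 2 := Nat.sub_add_cancel (Nat.one_le_pow _ _ hr)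
  have hpairs : (crossingPairs a A).card ≤ (r ^ 2 - 1 + 1) * w ^ 2 := by
    refine (Finset.card_filter_le _ _).trans ?_
    rw [hr2, Finset.card_product, ← mul_pow, sq]
    exact Nat.mul_le_mul hrw hrw
  obtain ⟨Z, hZ, hZI⟩ := exists_cut (crossingAbscissa a b) (w ^ 2) (r ^ 2 - 1) _ hpairs
  set cell : κ → ℕ × ℕ := fun p => ((Z.filter (· < x p)).card, level a b A (x p) (y p) / w)
    with hcell
  set C := Finset.range (r ^ 2) ×ˢ Finset.range r with hC
  set Q : ℕ × ℕ → Finset κ := fun c => P.filter fun p => x p ∉ Z ∧ cell p = c with hQ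
  have hline : ∀ l ∈ A, (P.filter fun p => y p = a l * x p + b l).card ≤
      Z.card + ∑ c ∈ C, ((Q c).filter fun p => y p = a l * x p + b l).card := by
    intro l hl
    rw [← Finset.card_filter_add_card_filter_not (fun p => x p ∈ Z)]
    refine add_le_add (Finset.card_le_card_of_injOn x
      (fun p hp => (Finset.mem_filter.1 hp).2) ?_) ?_
    · intro p hp q hq h
      simp only [Finset.coe_filter, Finset.mem_filter] at hp hq
      exact hxy p hp.1.1 q hq.1.1 h (by rw [hp.1.2, hq.1.2, h])
    · rw [Finset.card_eq_sum_card_fiberwise (f := cell) (t := C)]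
      · refine Finset.sum_le_sum fun c _ => Finset.card_le_card fun p hp => ?_
        simp only [hQ, Finset.mem_filter] at hp ⊢
        tauto
      · intro p hp
        simp only [Finset.coe_filter, Finset.mem_filter, Set.mem_ofPred_eq] at hp
        rw [Finset.mem_coe, hC, Finset.mem_product, Finset.mem_range, Finset.mem_range]
        constructor
        · have := Finset.card_filter_le Z (· < x p)
          simp only [hcell]
          omega
        -- The line `l` passes through the point, hence is not strictly below it: the level is less
        -- than `|A| ≤ r w`.
        · refine Nat.div_lt_of_lt_mul ?_
          refine lt_of_lt_of_le ?_ (hrw.trans (mul_comm r w).le)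
          refine Finset.card_lt_card (Finset.filter_ssubset.2 ⟨l, hl, ?_⟩)
          rw [hp.1.2]
          exact lt_irrefl _
  have hmeet : ∀ c ∈ C,
      (A.filter fun l => ∃ p ∈ Q c, y p = a l * x p + b l).card ≤ 4 * w := by
    rintro ⟨i, j⟩ -
    rcases (Q (i, j)).eq_empty_or_nonempty with h0 | ⟨p₀, hp₀⟩
    · simp [h0]
    have hslab : ∀ p ∈ Q (i, j), x p ∈ slab Z i ∧ level a b A (x p) (y p) / w = j := by
      intro p hp
      obtain ⟨-, hpZ, hpc⟩ := Finset.mem_filter.1 hp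
      rw [hcell, Prod.mk.injEq] at hpc
      exact ⟨⟨hpZ, hpc.1⟩, hpc.2⟩
    -- The abscissa of `p₀` may be that of a crossing; moving slightly to the right stays in the
    -- slab and separates the lines.
    obtain ⟨x₀, hx₀, hF⟩ := exists_gt_forall_notMem_Ioc
      (Z ∪ (A ×ˢ A).image (crossingAbscissa a b)) (x p₀)
    have hx₀I : x₀ ∈ slab Z i := mem_slab_of_forall (hslab p₀ hp₀).1 hx₀ fun z hz =>
      hF z (Finset.mem_union_left _ hz)
    have hinj : Set.InjOn (fun l => a l * x₀ + b l) A := by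
      intro l hl l' hl' h
      by_contra hne
      simp only at h
      have hne' : a l ≠ a l' := fun h0 => hne (hab l hl l' hl' h0 (by rw [h0] at h; linarith))
      have hX : crossingAbscissa a b (l, l') = x₀ := by
        rw [crossingAbscissa, div_eq_iff (sub_ne_zero.2 hne')]
        linear_combination -h
      rcases hF x₀ (Finset.mem_union_right _ (hX ▸ Finset.mem_image_of_mem _
        (Finset.mk_mem_product hl hl'))) with h1 | h1
      · exact absurd hx₀ (not_lt.2 h1)
      · exact lt_irrefl _ h1
    refine (Finset.card_le_card fun l hl => ?_).trans (card_lines_meeting_cell_le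
      (slab_ordConnected Z i) hw (hZI _ (slab_ordConnected Z i) fun z hz h => h.1 hz) hx₀I hinj j)
    rw [Finset.mem_filter] at hl ⊢
    obtain ⟨hlA, p, hp, hpl⟩ := hl
    refine ⟨hlA, x p, (hslab p hp).1, ?_⟩
    rw [← hpl]
    exact (hslab p hp).2
  have hcellsum : ∀ c ∈ C,
      ((∑ l ∈ A, ((Q c).filter fun p => y p = a l * x p + b l).card : ℕ) : ℝ) ≤
        (4 * w : ℕ) + (Q c).card * √(4 * w : ℕ) := by
    intro c hc
    refine sum_card_filter_le_add_mul_sqrt A (Q c) (fun l p => y p = a l * x p + b l) ?_ _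
      (hmeet c hc)
    intro l hl l' hl' hne p hp p' hp'
    have h := eq_of_two_common_points hab hxy l hl l' hl' hne p (Finset.mem_filter.1 hp).1 p'
      (Finset.mem_filter.1 hp').1
    exact h
  have hQsum : ∑ c ∈ C, (Q c).card ≤ P.card := by
    rw [← Finset.card_biUnion]
    · exact Finset.card_le_card (Finset.biUnion_subset.2 fun c _ => Finset.filter_subset _ _)
    · intro c _ c' _ hne
      refine Finset.disjoint_left.2 fun p hp hp' => hne ?_
      exact (Finset.mem_filter.1 hp).2.2.symm.trans (Finset.mem_filter.1 hp').2.2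
  have hsqrt : √((4 * w : ℕ) : ℝ) = 2 * √w := by
    rw [Nat.cast_mul, Real.sqrt_mul (by positivity), show ((4 : ℕ) : ℝ) = 2 ^ 2 by norm_num,
      Real.sqrt_sq (by norm_num)]
  have htotal : ∑ l ∈ A, (P.filter fun p => y p = a l * x p + b l).card ≤
      A.card * Z.card +
        ∑ c ∈ C, ∑ l ∈ A, ((Q c).filter fun p => y p = a l * x p + b l).card := by
    rw [Finset.sum_comm]
    refine (Finset.sum_le_sum hline).trans ?_
    rw [Finset.sum_add_distrib, Finset.sum_const, smul_eq_mul]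
  have hZr : (Z.card : ℝ) ≤ r ^ 2 := by exact_mod_cast hZ.trans (Nat.sub_le _ _)
  calc ((∑ l ∈ A, (P.filter fun p => y p = a l * x p + b l).card : ℕ) : ℝ)
      ≤ A.card * Z.card +
        ∑ c ∈ C, ((∑ l ∈ A, ((Q c).filter fun p => y p = a l * x p + b l).card : ℕ) : ℝ) := by
          exact_mod_cast htotal
    _ ≤ A.card * r ^ 2 + ∑ c ∈ C, ((4 * w : ℕ) + (Q c).card * (2 * √w)) := by
          rw [← hsqrt]
          gcongr with c hc
          exact hcellsum c hc
    _ = A.card * r ^ 2 + (r ^ 2 * r * (4 * w) + ((∑ c ∈ C, (Q c).card : ℕ) : ℝ) * (2 * √w)) := by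
          rw [Finset.sum_add_distrib, ← Finset.sum_mul, Finset.sum_const, hC,
            Finset.card_product, Finset.card_range, Finset.card_range, nsmul_eq_mul]
          push_cast
          ring
    _ ≤ A.card * r ^ 2 + (r ^ 2 * r * (4 * w) + P.card * (2 * √w)) := by
          gcongr
    _ = _ := by ring

open Classical in
/-- A weak Szemerédi–Trotter bound: if `t ≥ r` lines contain at least `k ≥ 18 r²` of the `n`
points each, then `k² t r ≤ 32 n²`. -/
theorem sq_mul_card_mul_le (hab : ∀ l ∈ A, ∀ l' ∈ A, a l = a l' → b l = b l' → l = l')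
    (hxy : ∀ p ∈ P, ∀ q ∈ P, x p = x q → y p = y q → p = q) {r k : ℕ} (hr : 0 < r)
    (hrt : r ≤ A.card) (hrk : 18 * r ^ 2 ≤ k)
    (hk : ∀ l ∈ A, k ≤ (P.filter fun p => y p = a l * x p + b l).card) :
    k ^ 2 * A.card * r ≤ 32 * P.card ^ 2 := by
  set w := (A.card + r - 1) / r with hwdef
  have hw : 0 < w := Nat.div_pos (by omega) hr
  have h1 : A.card ≤ r * w := by
    have := Nat.div_add_mod (A.card + r - 1) r
    have := Nat.mod_lt (A.card + r - 1) hr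
    rw [← hwdef] at *
    omega
  have h2 : r * w ≤ 2 * A.card := (Nat.mul_div_le _ _).trans (by omega)
  have hI := sum_card_incidences_le hab hxy hr hw h1
  have hkI : A.card * k ≤ ∑ l ∈ A, (P.filter fun p => y p = a l * x p + b l).card :=
    Finset.card_nsmul_le_sum A _ k hk
  have hkI' : (A.card : ℝ) * k ≤ 4 * r ^ 3 * w + r ^ 2 * A.card + P.card * (2 * √w) :=
    le_trans (by exact_mod_cast hkI) hI
  have h2' : (r : ℝ) * w ≤ 2 * A.card := by exact_mod_cast h2
  have hrk' : 18 * (r : ℝ) ^ 2 ≤ k := by exact_mod_cast hrk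
  have ht : (0 : ℝ) < A.card := by exact_mod_cast hr.trans_le hrt
  have hr' : (0 : ℝ) < r := by exact_mod_cast hr
  have hu : √(w : ℝ) ^ 2 = w := Real.sq_sqrt (Nat.cast_nonneg w)
  have hu0 := Real.sqrt_nonneg (w : ℝ)
  set u := √(w : ℝ)
  have h3 : 4 * (r : ℝ) ^ 3 * w ≤ 8 * r ^ 2 * A.card := by
    have := mul_le_mul_of_nonneg_left h2' (by positivity : 0 ≤ 4 * (r : ℝ) ^ 2)
    linarith
  -- The first two terms total at most `9 r² |A|`, which is at most half of `k |A|` because `18 r² ≤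
  -- k`.
  have h4 : (A.card : ℝ) * k ≤ 4 * P.card * u := by
    have := mul_le_mul_of_nonneg_left hrk' ht.le
    linarith
  have h5 : ((A.card : ℝ) * k) ^ 2 ≤ (4 * P.card * u) ^ 2 := by gcongr
  have h6 : ((A.card : ℝ) * k) ^ 2 * r ≤ 16 * (P.card : ℝ) ^ 2 * (2 * A.card) := by
    calc ((A.card : ℝ) * k) ^ 2 * r ≤ (4 * P.card * u) ^ 2 * r := by gcongr
      _ = 16 * (P.card : ℝ) ^ 2 * (r * w) := by rw [← hu]; ring
      _ ≤ _ := by gcongr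
  have h7 : (A.card : ℝ) * (k ^ 2 * A.card * r) ≤ A.card * (32 * P.card ^ 2) := by linarith
  exact_mod_cast le_of_mul_le_mul_left h7 ht

end RichLines

/-! ### Generic linear coordinates. -/

section Coordinates

variable {E F : Type*} [AddCommGroup E] [Module ℝ E] [Module.Finite ℝ E]
  [AddCommGroup F] [Module ℝ F] [Module.Finite ℝ F]

theorem exists_equiv_prod_of_ne_zero (h : Module.finrank ℝ E = Module.finrank ℝ F + 1)
    {f : E →ₗ[ℝ] ℝ} (hf : f ≠ 0) : ∃ e : E ≃ₗ[ℝ] ℝ × F, ∀ p, (e p).1 = f p := by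
  obtain ⟨g, hg⟩ := LinearMap.exists_leftInverse_of_injective (LinearMap.ker f).subtype
    (Submodule.ker_subtype _)
  have hk := finrank_ker_add_one hf
  let e₀ : LinearMap.ker f ≃ₗ[ℝ] F := LinearEquiv.ofFinrankEq _ _ (by omega)
  let φ : E →ₗ[ℝ] ℝ × F := f.prod (e₀.toLinearMap ∘ₗ g)
  have hinj : Function.Injective φ := by
    refine (injective_iff_map_eq_zero φ).2 fun x hx => ?_
    have h1 : f x = 0 := congrArg Prod.fst hx
    have h2 : e₀ (g x) = 0 := congrArg Prod.snd hx
    have h3 := LinearMap.congr_fun hg ⟨x, h1⟩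
    rw [LinearEquiv.map_eq_zero_iff] at h2
    simp only [LinearMap.comp_apply, Submodule.subtype_apply, h2, LinearMap.id_apply] at h3
    exact (congrArg Subtype.val h3).symm
  have hrank : Module.finrank ℝ E = Module.finrank ℝ (ℝ × F) := by
    rw [Module.finrank_prod, Module.finrank_self]; omega
  exact ⟨LinearEquiv.ofInjectiveOfFinrankEq φ hinj hrank, fun p => rfl⟩

variable (F) in
/-- Linear coordinates in which the points of `P` have distinct first coordinates. -/
theorem exists_equiv_prod_injOn (h : Module.finrank ℝ E = Module.finrank ℝ F + 1)
    (P : Finset E) : ∃ e : E ≃ₗ[ℝ] ℝ × F, Set.InjOn (fun p => (e p).1) P := by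
  classical
  have : Nontrivial E := Module.nontrivial_of_finrank_pos (R := ℝ) (by omega)
  obtain ⟨v, hv⟩ := exists_ne (0 : E)
  -- Adding `0` and `v` forces `f ≠ 0` even when `P` has fewer than two points.
  obtain ⟨f, hf⟩ := exists_dual_injOn (insert 0 (insert v P))
  have hf0 : f ≠ 0 := fun h0 => hv (hf (by simp) (by simp) (by simp [h0]))
  obtain ⟨e, he⟩ := exists_equiv_prod_of_ne_zero (F := F) h hf0
  refine ⟨e, fun p hp q hq hpq => hf ?_ ?_ ?_⟩
  · simp [Finset.mem_coe.1 hp]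
  · simp [Finset.mem_coe.1 hq]
  · simpa [he] using hpq

end Coordinates

/-! ### Beck's theorem. -/

section Beck

variable {E : Type*} [AddCommGroup E] [Module ℝ E]

theorem exists_slope_intercept {P : Finset E} {e : E ≃ₗ[ℝ] ℝ × ℝ}
    (he : Set.InjOn (fun p => (e p).1) P) {L : AffineSubspace ℝ E} (hL : L ∈ lineFinset P) :
    ∃ a b : ℝ, ∀ p, p ∈ L ↔ (e p).2 = a * (e p).1 + b := by
  obtain ⟨p, hp, q, hq, hne, rfl⟩ := mem_lineFinset.1 hL
  have hx : (e q).1 - (e p).1 ≠ 0 := sub_ne_zero.2 fun h => hne (he hq hp h).symm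
  refine ⟨((e q).2 - (e p).2) / ((e q).1 - (e p).1),
    (e p).2 - ((e q).2 - (e p).2) / ((e q).1 - (e p).1) * (e p).1, fun z => ?_⟩
  rw [mem_affineSpan_pair_iff_exists_lineMap_eq]
  constructor
  · rintro ⟨t, rfl⟩
    simp only [AffineMap.lineMap_apply, vsub_eq_sub, vadd_eq_add, map_add, map_smul, map_sub,
      Prod.snd_add, Prod.fst_add, Prod.smul_fst, Prod.smul_snd, Prod.fst_sub, Prod.snd_sub,
      smul_eq_mul]
    field_simp
    ring
  · intro hz
    refine ⟨((e z).1 - (e p).1) / ((e q).1 - (e p).1), e.injective (Prod.ext ?_ ?_)⟩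
    · simp only [AffineMap.lineMap_apply, vsub_eq_sub, vadd_eq_add, map_add, map_smul, map_sub,
        Prod.fst_add, Prod.smul_fst, Prod.fst_sub, smul_eq_mul]
      field_simp
      ring
    · simp only [AffineMap.lineMap_apply, vsub_eq_sub, vadd_eq_add, map_add, map_smul, map_sub,
        Prod.snd_add, Prod.smul_snd, Prod.snd_sub, smul_eq_mul]
      rw [hz]
      field_simp
      ring

open Classical in
theorem card_mul_card_sub_one_le (P : Finset E) :
    P.card * (P.card - 1) ≤ ∑ L ∈ lineFinset P, (P.filter (· ∈ L)).card ^ 2 := by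
  rw [Nat.mul_sub_one, ← Finset.offDiag_card,
    Finset.card_eq_sum_card_fiberwise (f := fun x : E × E => line[ℝ, x.1, x.2])
      (t := lineFinset P)]
  · refine Finset.sum_le_sum fun L _ => ?_
    rw [sq, ← Finset.card_product]
    refine Finset.card_le_card fun x hx => ?_
    simp only [Finset.mem_filter, Finset.mem_offDiag, Finset.mem_product] at hx ⊢
    obtain ⟨⟨h1, h2, -⟩, rfl⟩ := hx
    exact ⟨⟨h1, left_mem_affineSpan_pair ..⟩, h2, right_mem_affineSpan_pair ..⟩
  · intro x hx
    obtain ⟨h1, h2, h3⟩ := Finset.mem_offDiag.1 hx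
    exact mem_lineFinset.2 ⟨_, h1, _, h2, h3, rfl⟩

open Classical in
/-- Bound for the number of lines containing at least `18 · 4 ^ j` points of a planar set. -/
theorem card_rich_lines_mul_le [Module.Finite ℝ E] (hE : Module.finrank ℝ E = 2) (P : Finset E)
    (j : ℕ) :
    (((lineFinset P).filter fun L => 18 * 4 ^ j ≤ (P.filter (· ∈ L)).card).card : ℝ) * 16 ^ j ≤
      P.card ^ 2 * (1 / 2) ^ j + P.card * 4 ^ j / 9 := by
  obtain ⟨e, he⟩ := exists_equiv_prod_injOn ℝ (by simpa using hE) P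
  have hab : ∀ L : AffineSubspace ℝ E, ∃ ab : ℝ × ℝ, L ∈ lineFinset P →
      ∀ p, p ∈ L ↔ (e p).2 = ab.1 * (e p).1 + ab.2 := by
    intro L
    by_cases hL : L ∈ lineFinset P
    · obtain ⟨a, b, h⟩ := exists_slope_intercept he hL
      exact ⟨(a, b), fun _ => h⟩
    · exact ⟨0, fun h => absurd h hL⟩
  choose ab hab using hab
  set T := (lineFinset P).filter fun L => 18 * 4 ^ j ≤ (P.filter (· ∈ L)).card with hT
  have hTL : ∀ L ∈ T, L ∈ lineFinset P := fun L hL => (Finset.mem_filter.1 hL).1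
  have hinj : ∀ L ∈ T, ∀ L' ∈ T, (ab L).1 = (ab L').1 → (ab L).2 = (ab L').2 → L = L' := by
    intro L hL L' hL' h1 h2
    ext p
    rw [hab L (hTL L hL), hab L' (hTL L' hL'), h1, h2]
  have hP : ∀ p ∈ P, ∀ q ∈ P, (e p).1 = (e q).1 → (e p).2 = (e q).2 → p = q :=
    fun p hp q hq h _ => he hp hq h
  have hk : ∀ L ∈ T, 18 * 4 ^ j ≤
      (P.filter fun p => (e p).2 = (ab L).1 * (e p).1 + (ab L).2).card := by
    intro L hL
    simp only [← hab L (hTL L hL)]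
    exact (Finset.mem_filter.1 hL).2
  have h1 : (0 : ℝ) ≤ P.card ^ 2 * (1 / 2) ^ j := by positivity
  have h2 : (0 : ℝ) ≤ P.card * 4 ^ j / 9 := by positivity
  have hhalf : (2 : ℝ) ^ j * (1 / 2) ^ j = 1 := by rw [← mul_pow]; norm_num
  -- With at least `2 ^ j` lines, the weak Szemerédi–Trotter bound applies with `r = 2 ^ j`. With
  -- fewer, either `8 ^ j ≤ |P|` and the count itself is small enough, or `|P| < 8 ^ j` and the
  -- trivial bound for very rich lines gives the second term.
  rcases le_or_gt (2 ^ j) T.card with hle | hlt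
  · have := sq_mul_card_mul_le (P := P) (x := fun p => (e p).1) (y := fun p => (e p).2)
      hinj hP (r := 2 ^ j) (k := 18 * 4 ^ j)
      (by positivity) hle (by rw [← pow_mul, mul_comm j, pow_mul]; norm_num) hk
    have h3 : ((18 * 4 ^ j) ^ 2 * T.card * 2 ^ j : ℝ) ≤ 32 * P.card ^ 2 := by exact_mod_cast this
    have h16 : ((4 : ℝ) ^ j) ^ 2 = 16 ^ j := by rw [← pow_mul, mul_comm, pow_mul]; norm_num
    have h4 : (324 * (T.card * 16 ^ j) * (2 ^ j * (1 / 2) ^ j) : ℝ) ≤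
        32 * (P.card ^ 2 * (1 / 2) ^ j) := by
      have := mul_le_mul_of_nonneg_right h3 (by positivity : (0 : ℝ) ≤ (1 / 2) ^ j)
      rw [mul_pow, h16] at this
      linarith
    rw [hhalf] at h4
    linarith
  · rcases le_or_gt (8 ^ j) P.card with h8 | h8
    · have h3 : (T.card : ℝ) ≤ 2 ^ j := by exact_mod_cast hlt.le
      have h4 : (8 : ℝ) ^ j ≤ P.card := by exact_mod_cast h8
      have h5 : (T.card : ℝ) * 16 ^ j ≤ P.card ^ 2 * (1 / 2) ^ j := by
        calc (T.card : ℝ) * 16 ^ j ≤ 2 ^ j * 16 ^ j := by gcongr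
          _ = (8 ^ j) ^ 2 * (1 / 2) ^ j := by
            rw [← pow_mul, mul_comm j 2, pow_mul, ← mul_pow, ← mul_pow]; norm_num
          _ ≤ _ := by gcongr
      linarith
    · have h816 : 8 ^ j ≤ 16 ^ j := Nat.pow_le_pow_left (by norm_num) j
      have := mul_card_le_two_mul_of_sq_lt T P
        (fun L p => (e p).2 = (ab L).1 * (e p).1 + (ab L).2)
        (eq_of_two_common_points (x := fun p => (e p).1) (y := fun p => (e p).2) hinj hP)
        (18 * 4 ^ j) hk (by
          rw [mul_pow, ← pow_mul, mul_comm j, pow_mul]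
          norm_num
          omega)
      have h3 : (18 * 4 ^ j * T.card : ℝ) ≤ 2 * P.card := by exact_mod_cast this
      have h16 : (4 : ℝ) ^ j * 4 ^ j = 16 ^ j := by rw [← mul_pow]; norm_num
      have h4 := mul_le_mul_of_nonneg_right h3 (by positivity : (0 : ℝ) ≤ 4 ^ j)
      rw [← h16]
      linarith

theorem sum_four_pow_le (y : ℝ) (hy : 0 ≤ y) (J : ℕ) :
    ∑ j ∈ (Finset.range J).filter (fun j => (4 : ℝ) ^ j ≤ y), (4 : ℝ) ^ j ≤ 4 / 3 * y := by
  induction J with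
  | zero => simpa using hy
  | succ J ih =>
    by_cases h : (4 : ℝ) ^ J ≤ y
    · refine (Finset.sum_le_sum_of_subset_of_nonneg (Finset.filter_subset _ _)
        fun _ _ _ => by positivity).trans ?_
      rw [geom_sum_eq (by norm_num), pow_succ]
      linarith
    · rwa [Finset.range_add_one, Finset.filter_insert, if_neg h]

open Classical in
-- Lines are grouped by richness between `18 · 4 ^ j` and `72 · 4 ^ j`, so that `N L ^ 2` is at most
-- `5184 · 16 ^ j`. The first term of the rich line bound sums to a geometric tail; the second is
-- summed only up to `4 ^ j ≤ n / 18000`, where `hP` stops it.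
theorem sum_sq_rich_lines_le [Module.Finite ℝ E] (hE : Module.finrank ℝ E = 2) (P : Finset E)
    (hP : ∀ L ∈ lineFinset P, ((P.filter (· ∈ L)).card : ℝ) ≤ 1 / 1000 * P.card) :
    ((∑ L ∈ (lineFinset P).filter (fun L => 18 * 4 ^ 16 ≤ (P.filter (· ∈ L)).card),
      (P.filter (· ∈ L)).card ^ 2 : ℕ) : ℝ) ≤ 1 / 4 * P.card ^ 2 := by
  set N : AffineSubspace ℝ E → ℕ := fun L => (P.filter (· ∈ L)).card with hN
  set n := P.card with hn
  set T : ℕ → Finset (AffineSubspace ℝ E) := fun j =>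
    (lineFinset P).filter fun L => 18 * 4 ^ j ≤ N L with hT
  have hNn : ∀ L, N L ≤ n := fun L => Finset.card_filter_le _ _
  have h1 : ∀ L ∈ T 16, N L ^ 2 ≤
      ∑ j ∈ Finset.Ico 16 (n + 1), if 18 * 4 ^ j ≤ N L then 5184 * 16 ^ j else 0 := by
    intro L hL
    have hL16 := (Finset.mem_filter.1 hL).2
    set m := N L / 18 with hm
    have hm0 : m ≠ 0 := by
      have : 4 ^ 16 ≤ m := (Nat.le_div_iff_mul_le (by norm_num)).2 (by omega)
      positivity
    have hlo : 4 ^ Nat.log 4 m ≤ m := Nat.pow_log_le_self 4 hm0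
    have hhi : m < 4 ^ (Nat.log 4 m + 1) := Nat.lt_pow_succ_log_self (by norm_num) m
    have h16 : 16 ≤ Nat.log 4 m := (Nat.le_log_iff_pow_le (by norm_num) hm0).2
      ((Nat.le_div_iff_mul_le (by norm_num)).2 (by omega))
    set i := Nat.log 4 m
    have hin : i < n + 1 := by
      have : i < 4 ^ i := Nat.lt_pow_self (by norm_num)
      have := hNn L
      omega
    have hsingle := Finset.single_le_sum (s := Finset.Ico 16 (n + 1))
      (f := fun j => if 18 * 4 ^ j ≤ N L then 5184 * 16 ^ j else 0)
      (fun _ _ => Nat.zero_le _) (Finset.mem_Ico.2 ⟨h16, hin⟩)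
    refine le_trans ?_ hsingle
    rw [if_pos (by omega)]
    have h4 : N L ≤ 72 * 4 ^ i := by rw [pow_succ] at hhi; omega
    calc N L ^ 2 ≤ (72 * 4 ^ i) ^ 2 := Nat.pow_le_pow_left h4 2
      _ = 5184 * 16 ^ i := by rw [mul_pow, ← pow_mul, mul_comm i, pow_mul]; norm_num
  have h2 : ∑ L ∈ T 16, N L ^ 2 ≤
      ∑ j ∈ Finset.Ico 16 (n + 1), 5184 * ((T j).card * 16 ^ j) := by
    refine (Finset.sum_le_sum h1).trans ?_
    rw [Finset.sum_comm]
    refine Finset.sum_le_sum fun j _ => ?_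
    rw [← Finset.sum_filter, Finset.sum_const, smul_eq_mul]
    have : ((T 16).filter fun L => 18 * 4 ^ j ≤ N L).card ≤ (T j).card :=
      Finset.card_le_card fun L hL => by
        simp only [hT, Finset.mem_filter] at hL ⊢
        exact ⟨hL.1.1, hL.2⟩
    nlinarith [Nat.mul_le_mul_right (5184 * 16 ^ j) this]
  have h3 : ∀ j, ((T j).card : ℝ) * 16 ^ j ≤ n ^ 2 * (1 / 2) ^ j +
      n / 9 * if (4 : ℝ) ^ j ≤ n / 18000 then 4 ^ j else 0 := by
    intro j
    split_ifs with hj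
    · have := card_rich_lines_mul_le hE P j
      refine this.trans_eq ?_
      ring
    · rw [Finset.card_eq_zero.2]
      · simp only [Nat.cast_zero, zero_mul]
        positivity
      · refine Finset.filter_eq_empty_iff.2 fun L hL hle => hj ?_
        have h4 := hP L hL
        have h5 : (18 * 4 ^ j : ℝ) ≤ N L := by exact_mod_cast hle
        linarith
  have hgeom : ∑ j ∈ Finset.Ico 16 (n + 1), (1 / 2 : ℝ) ^ j ≤ 1 / 32768 := by
    exact (geom_sum_Ico_le_of_lt_one (by norm_num) (by norm_num)).trans_eq (by norm_num)
  have hfour : ∑ j ∈ Finset.Ico 16 (n + 1), (if (4 : ℝ) ^ j ≤ n / 18000 then (4 : ℝ) ^ j else 0) ≤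
      4 / 3 * (n / 18000) := by
    refine le_trans ?_ (sum_four_pow_le (n / 18000) (by positivity) (n + 1))
    rw [Finset.sum_filter]
    refine Finset.sum_le_sum_of_subset_of_nonneg (fun j hj => ?_) fun j _ _ => by positivity
    exact Finset.mem_range.2 (Finset.mem_Ico.1 hj).2
  calc ((∑ L ∈ T 16, N L ^ 2 : ℕ) : ℝ)
      ≤ ∑ j ∈ Finset.Ico 16 (n + 1), (5184 : ℝ) * (((T j).card : ℝ) * 16 ^ j) := by exact_mod_cast h2
    _ ≤ ∑ j ∈ Finset.Ico 16 (n + 1), 5184 * ((n : ℝ) ^ 2 * (1 / 2) ^ j +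
          (n : ℝ) / 9 * if (4 : ℝ) ^ j ≤ (n : ℝ) / 18000 then (4 : ℝ) ^ j else 0) := by
        gcongr with j _
        exact h3 j
    _ = 5184 * ((n : ℝ) ^ 2 * ∑ j ∈ Finset.Ico 16 (n + 1), (1 / 2 : ℝ) ^ j +
          (n : ℝ) / 9 * ∑ j ∈ Finset.Ico 16 (n + 1), if (4 : ℝ) ^ j ≤ (n : ℝ) / 18000 then (4 : ℝ) ^ j else 0) := by
        rw [← Finset.mul_sum, Finset.sum_add_distrib, Finset.mul_sum, Finset.mul_sum]
    -- The tail from `j = 16` contributes about `0.16 n²` and the other term about `0.04 n²`, which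
    -- is what the thresholds `16` and `1 / 1000` are for.
    _ ≤ 5184 * ((n : ℝ) ^ 2 * (1 / 32768) + (n : ℝ) / 9 * (4 / 3 * ((n : ℝ) / 18000))) := by gcongr
    _ ≤ 1 / 4 * (n : ℝ) ^ 2 := by nlinarith [sq_nonneg (n : ℝ)]

end Beck

/-- Beck's theorem with explicit constants. -/
theorem isBeckPair_explicit : IsBeckPair (1 / 1000) (1 / (4 * (18 * 4 ^ 16) ^ 2)) := by
  classical
  refine ⟨by norm_num, by norm_num, fun P hP => ?_⟩
  have hE : Module.finrank ℝ (EuclideanSpace ℝ (Fin 2)) = 2 := by simp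
  rw [ncard_spannedLines]
  simp only [ncard_inter_eq_card_filter] at hP
  rcases P.eq_empty_or_nonempty with rfl | ⟨p, hp⟩
  · simp
  obtain ⟨q, hq⟩ := exists_ne p
  -- Any line through `p`, even with `q` outside `P`, contains a point of `P`, so `1 ≤ |P| / 1000`.
  have hn : (1000 : ℝ) ≤ P.card := by
    have h1 := hP _ (isLine_affineSpan_pair hq.symm)
    have h2 : (1 : ℝ) ≤ (P.filter (· ∈ line[ℝ, p, q])).card := by
      exact_mod_cast Finset.card_pos.2 ⟨p, by simp [hp, left_mem_affineSpan_pair]⟩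
    linarith
  have h1 := card_mul_card_sub_one_le P
  have h2 := sum_sq_rich_lines_le hE P fun L hL => hP L (isLine_of_mem_lineFinset hL)
  rw [← Finset.sum_filter_add_sum_filter_not _
    (fun L => 18 * 4 ^ 16 ≤ (P.filter (· ∈ L)).card)] at h1
  have h3 : ∑ L ∈ (lineFinset P).filter (fun L => ¬ 18 * 4 ^ 16 ≤ (P.filter (· ∈ L)).card),
      (P.filter (· ∈ L)).card ^ 2 ≤ (lineFinset P).card * (18 * 4 ^ 16) ^ 2 := by
    refine (Finset.sum_le_card_nsmul _ _ ((18 * 4 ^ 16) ^ 2) fun L hL => ?_).trans ?_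
    · exact Nat.pow_le_pow_left (not_le.1 (Finset.mem_filter.1 hL).2).le 2
    · rw [smul_eq_mul]
      exact Nat.mul_le_mul_right _ (Finset.card_filter_le _ _)
  have h4 : (P.card : ℝ) * (P.card - 1) ≤
      1 / 4 * P.card ^ 2 + (lineFinset P).card * (18 * 4 ^ 16) ^ 2 := by
    have h5 : ((P.card * (P.card - 1) : ℕ) : ℝ) = (P.card : ℝ) * (P.card - 1) := by
      rw [Nat.cast_mul, Nat.cast_sub (Finset.card_pos.2 ⟨p, hp⟩), Nat.cast_one]
    rw [← h5]
    refine (Nat.cast_le.2 (h1.trans (Nat.add_le_add_left h3 _))).trans ?_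
    rw [Nat.cast_add]
    refine add_le_add h2 (le_of_eq ?_)
    push_cast
    ring
  have h6 : 1 / 4 * (P.card : ℝ) ^ 2 ≤ (lineFinset P).card * (18 * 4 ^ 16) ^ 2 := by nlinarith
  rw [one_div, inv_mul_le_iff₀ (by positivity)]
  linarith

/-! ### The Sylvester–Gallai theorem. -/

section SylvesterGallai

variable {V : Type*} [NormedAddCommGroup V] [InnerProductSpace ℝ V]

/-- Kelly's inequality. With the foot of the perpendicular as origin, `d` is the apex and `s • u`,
`t • u` lie on the line, the latter on the same side and no farther out, or at the foot. It is then
closer to the line joining the apex to `s • u` than the apex is to the original line. The witness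
`τ` is the orthogonal projection coefficient. -/
theorem exists_norm_sub_sub_smul_lt {u d : V} (hd : d ≠ 0) (hud : inner ℝ u d = 0) {s t : ℝ}
    (hst : t ^ 2 ≤ s * t) : ∃ τ : ℝ, ‖(t - s) • u - τ • (d - s • u)‖ < ‖d‖ := by
  have hD : 0 < ‖d‖ ^ 2 := by positivity
  have hQ : 0 < s ^ 2 * ‖u‖ ^ 2 + ‖d‖ ^ 2 := by positivity
  refine ⟨s * (s - t) * ‖u‖ ^ 2 / (s ^ 2 * ‖u‖ ^ 2 + ‖d‖ ^ 2), ?_⟩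
  set τ := s * (s - t) * ‖u‖ ^ 2 / (s ^ 2 * ‖u‖ ^ 2 + ‖d‖ ^ 2) with hτ
  refine lt_of_pow_lt_pow_left₀ 2 (norm_nonneg d) ?_
  have h1 : (t - s) • u - τ • (d - s • u) = (t - s + τ * s) • u - τ • d := by module
  rw [h1, norm_sub_sq_real, inner_smul_left, inner_smul_right, hud, norm_smul, norm_smul,
    mul_pow, mul_pow, Real.norm_eq_abs, Real.norm_eq_abs, sq_abs, sq_abs]
  have h2 : (t - s + τ * s) ^ 2 * ‖u‖ ^ 2 - 2 * ((starRingEnd ℝ) (t - s + τ * s) * (τ * 0)) +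
      τ ^ 2 * ‖d‖ ^ 2 =
      (s - t) ^ 2 * ‖u‖ ^ 2 * ‖d‖ ^ 2 / (s ^ 2 * ‖u‖ ^ 2 + ‖d‖ ^ 2) := by
    rw [hτ]
    field_simp
    ring
  rw [h2, div_lt_iff₀ hQ]
  have h3 : (s - t) ^ 2 ≤ s ^ 2 := by nlinarith
  nlinarith [mul_le_mul_of_nonneg_right h3 (by positivity : 0 ≤ ‖u‖ ^ 2 * ‖d‖ ^ 2)]

/-- Two of three reals have a nonnegative product; `m` is the one of smaller absolute value. -/
theorem exists_sq_le_mul_of_three {ι : Type*} (f : ι → ℝ) {i j k : ι} (hij : f i ≠ f j)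
    (hik : f i ≠ f k) (hjk : f j ≠ f k) :
    ∃ l ∈ ({i, j, k} : Set ι), ∃ m ∈ ({i, j, k} : Set ι), f l ≠ f m ∧ f m ^ 2 ≤ f l * f m := by
  have key : ∀ l m : ι, f l ≠ f m → 0 ≤ f l * f m → f m ^ 2 ≤ f l * f m ∨ f l ^ 2 ≤ f m * f l := by
    intro l m _ h
    by_contra! hc
    nlinarith [sq_nonneg (f l - f m)]
  have hpair : 0 ≤ f i * f j ∨ 0 ≤ f i * f k ∨ 0 ≤ f j * f k := by
    by_contra! hc
    have h1 := mul_pos_of_neg_of_neg hc.1 hc.2.1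
    have h2 := mul_neg_of_pos_of_neg h1 hc.2.2
    nlinarith [sq_nonneg (f i * f j * f k), sq_nonneg (f i * (f j * f k))]
  rcases hpair with h | h | h
  · rcases key i j hij h with h' | h'
    · exact ⟨i, by simp, j, by simp, hij, h'⟩
    · exact ⟨j, by simp, i, by simp, hij.symm, h'⟩
  · rcases key i k hik h with h' | h'
    · exact ⟨i, by simp, k, by simp, hik, h'⟩
    · exact ⟨k, by simp, i, by simp, hik.symm, h'⟩
  · rcases key j k hjk h with h' | h'
    · exact ⟨j, by simp, k, by simp, hjk, h'⟩
    · exact ⟨k, by simp, j, by simp, hjk.symm, h'⟩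

open Classical in
/-- The Sylvester–Gallai theorem. -/
theorem exists_card_filter_eq_two (P : Finset V)
    (hP : ∃ L ∈ lineFinset P, ∃ r ∈ P, r ∉ L) :
    ∃ L ∈ lineFinset P, (P.filter (· ∈ L)).card = 2 := by
  -- Kelly's extremal choice: a spanned line and a point off it at minimal distance.
  obtain ⟨⟨L, r⟩, hmem, hmin⟩ := Finset.exists_min_image
    ((lineFinset P ×ˢ P).filter fun x => x.2 ∉ x.1)
    (fun x => Metric.infDist x.2 (x.1 : Set V)) (by
      obtain ⟨L, hL, r, hr, hrL⟩ := hP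
      exact ⟨(L, r), by simp [hL, hr, hrL]⟩)
  simp only [Finset.mem_filter, Finset.mem_product] at hmem hmin
  obtain ⟨⟨hL, hr⟩, hrL⟩ := hmem
  refine ⟨L, hL, ?_⟩
  by_contra hcard
  have hline := isLine_of_mem_lineFinset hL
  obtain ⟨p, hp, q, hq, hpq, rfl⟩ := mem_lineFinset.1 hL
  have h2 : 2 < (P.filter (· ∈ line[ℝ, p, q])).card := by
    refine lt_of_le_of_ne ?_ (Ne.symm hcard)
    exact Finset.one_lt_card.2 ⟨p, by simp [hp, left_mem_affineSpan_pair], q,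
      by simp [hq, right_mem_affineSpan_pair], hpq⟩
  set u := q - p with hu
  have hu0 : ‖u‖ ^ 2 ≠ 0 := by
    have : u ≠ 0 := sub_ne_zero.2 hpq.symm
    positivity
  set h := p + (inner ℝ u (r - p) / ‖u‖ ^ 2) • u with hh
  have hud : inner ℝ u (r - h) = 0 := by
    rw [hh, ← sub_sub, inner_sub_right, inner_smul_right, real_inner_self_eq_norm_sq,
      div_mul_cancel₀ _ hu0, sub_self]
  have hpar : ∀ x, x ∈ line[ℝ, p, q] → ∃ t : ℝ, x = h + t • u := by
    intro x hx
    obtain ⟨t, rfl⟩ := mem_affineSpan_pair_iff_exists_lineMap_eq.1 hx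
    refine ⟨t - inner ℝ u (r - p) / ‖u‖ ^ 2, ?_⟩
    rw [AffineMap.lineMap_apply, vsub_eq_sub, vadd_eq_add, hh, ← hu]
    module
  have hhL : h ∈ line[ℝ, p, q] := by
    rw [mem_affineSpan_pair_iff_exists_lineMap_eq]
    refine ⟨inner ℝ u (r - p) / ‖u‖ ^ 2, ?_⟩
    rw [AffineMap.lineMap_apply, vsub_eq_sub, vadd_eq_add, hh, ← hu, add_comm]
  have hd : r - h ≠ 0 := fun h0 => hrL (sub_eq_zero.1 h0 ▸ hhL)
  have hdist : ‖r - h‖ ≤ Metric.infDist r (line[ℝ, p, q] : Set V) := by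
    refine (Metric.le_infDist ⟨p, left_mem_affineSpan_pair ..⟩).2 fun {y} hy => ?_
    obtain ⟨t, rfl⟩ := hpar y hy
    rw [dist_eq_norm, show r - (h + t • u) = r - h - t • u from (sub_sub _ _ _).symm]
    refine le_of_sq_le_sq ?_ (norm_nonneg _)
    have h0 : inner ℝ (r - h) (t • u) = 0 := by
      rw [inner_smul_right, real_inner_comm, hud, mul_zero]
    rw [norm_sub_sq_real (r - h), h0]
    nlinarith [sq_nonneg ‖t • u‖]
  choose! f hf using hpar
  obtain ⟨x, hx, y, hy, z, hz, hxy, hxz, hyz⟩ := Finset.two_lt_card.1 h2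
  have hne : ∀ x ∈ P.filter (· ∈ line[ℝ, p, q]), ∀ y ∈ P.filter (· ∈ line[ℝ, p, q]),
      x ≠ y → f x ≠ f y := by
    intro x hx y hy hxy h0
    rw [Finset.mem_filter] at hx hy
    exact hxy (by rw [hf x hx.2, hf y hy.2, h0])
  obtain ⟨a, ha, b, hb, hab, hsq⟩ := exists_sq_le_mul_of_three f (hne x hx y hy hxy)
    (hne x hx z hz hxz) (hne y hy z hz hyz)
  have hmemP : ∀ a ∈ ({x, y, z} : Set V), a ∈ P ∧ a ∈ line[ℝ, p, q] := by
    rintro a (rfl | rfl | rfl)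
    exacts [Finset.mem_filter.1 hx, Finset.mem_filter.1 hy, Finset.mem_filter.1 hz]
  obtain ⟨haP, haL⟩ := hmemP a ha
  obtain ⟨hbP, hbL⟩ := hmemP b hb
  have hra : r ≠ a := fun h0 => hrL (h0 ▸ haL)
  have hbM : b ∉ line[ℝ, r, a] := fun hbM => hrL <| by
    rw [hline.eq_of_mem (isLine_affineSpan_pair hra) (fun h0 : a = b => hab (congrArg f h0))
      haL hbL (right_mem_affineSpan_pair ..) hbM]
    exact left_mem_affineSpan_pair ..
  have hle := hmin (line[ℝ, r, a], b)
    ⟨⟨mem_lineFinset.2 ⟨r, hr, a, haP, hra, rfl⟩, hbP⟩, hbM⟩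
  obtain ⟨τ, hτ⟩ := exists_norm_sub_sub_smul_lt hd hud hsq
  have hmem : a + τ • (r - a) ∈ line[ℝ, r, a] := by
    rw [mem_affineSpan_pair_iff_exists_lineMap_eq]
    refine ⟨1 - τ, ?_⟩
    rw [AffineMap.lineMap_apply, vsub_eq_sub, vadd_eq_add]
    module
  have hlt : Metric.infDist b (line[ℝ, r, a] : Set V) < ‖r - h‖ := by
    refine (Metric.infDist_le_dist_of_mem hmem).trans_lt ?_
    have h1 := hf a haL
    have h2 := hf b hbL
    have h3 : b - (a + τ • (r - a)) = (f b - f a) • u - τ • (r - h - f a • u) := by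
      have h4 : b - a = (f b - f a) • u := by
        nth_rewrite 1 [h1, h2]
        module
      have h5 : r - a = r - h - f a • u := by
        nth_rewrite 1 [h1]
        module
      rw [← h4, ← h5]
      module
    rw [dist_eq_norm, h3]
    exact hτ
  linarith

end SylvesterGallai

/-- The parabola shows that the second of two Beck constants is at most `1/2`. -/
theorem IsBeckPair.le_half {β γ : ℝ} (h : IsBeckPair β γ) : γ ≤ 1 / 2 := by
  classical
  obtain ⟨hβ, -, hB⟩ := h
  obtain ⟨N, hN⟩ := exists_nat_ge (2 / β)
  have hN0 : (0 : ℝ) < N := (div_pos two_pos hβ).trans_le hN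
  set g : ℕ → EuclideanSpace ℝ (Fin 2) := fun i => !₂[(i : ℝ), (i : ℝ) ^ 2] with hg
  have hg0 : ∀ i, g i 0 = i := fun i => by simp [hg]
  have hg1 : ∀ i, g i 1 = (i : ℝ) ^ 2 := fun i => by simp [hg]
  have hinj : Function.Injective g := fun i j hij => by
    have := congrArg (fun v : EuclideanSpace ℝ (Fin 2) => v 0) hij
    simpa [hg0] using this
  set P := (Finset.range N).image g with hP
  have hcard : P.card = N := by rw [hP, Finset.card_image_of_injective _ hinj, Finset.card_range]
  have hspan := hB P fun L hL => by
    have h2 : (P.filter (· ∈ L)).card ≤ 2 := by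
      by_contra! hlt
      obtain ⟨x, hx, y, hy, z, hz, hxy, hxz, hyz⟩ := Finset.two_lt_card.1 hlt
      simp only [hP, Finset.mem_filter, Finset.mem_image] at hx hy hz
      obtain ⟨⟨i, -, rfl⟩, hi⟩ := hx
      obtain ⟨⟨j, -, rfl⟩, hj⟩ := hy
      obtain ⟨⟨k, -, rfl⟩, hk⟩ := hz
      rw [hL.eq_affineSpan_pair hi hj hxy, mem_affineSpan_pair_iff_exists_lineMap_eq] at hk
      obtain ⟨t, ht⟩ := hk
      have h0 := congrArg (fun v : EuclideanSpace ℝ (Fin 2) => v 0) ht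
      have h1 := congrArg (fun v : EuclideanSpace ℝ (Fin 2) => v 1) ht
      simp only [AffineMap.lineMap_apply, vsub_eq_sub, vadd_eq_add, PiLp.add_apply,
        PiLp.smul_apply, PiLp.sub_apply, smul_eq_mul, hg0, hg1] at h0 h1
      -- The chord through the points of abscissae `i` and `j` has equation `y = (i + j) x - i j`.
      have h3 : ((k : ℝ) - i) * (k - j) = 0 := by
        linear_combination -h1 + ((i : ℝ) + j) * h0
      rcases mul_eq_zero.1 h3 with h4 | h4
      · exact hxz (congrArg g (by exact_mod_cast (sub_eq_zero.1 h4).symm))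
      · exact hyz (congrArg g (by exact_mod_cast (sub_eq_zero.1 h4).symm))
    rw [ncard_inter_eq_card_filter, hcard]
    rw [div_le_iff₀ hβ] at hN
    have : ((P.filter (· ∈ L)).card : ℝ) ≤ 2 := by exact_mod_cast h2
    linarith
  rw [ncard_spannedLines] at hspan
  have h1 : 2 * (lineFinset P).card ≤ P.card * P.card :=
    (two_mul_card_lineFinset_le P).trans (Nat.mul_le_mul_left _ (Nat.sub_le _ _))
  have h2 : 2 * ((lineFinset P).card : ℝ) ≤ P.card * P.card := by exact_mod_cast h1
  rw [hcard] at hspan h2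
  have h3 : γ * (N : ℝ) ^ 2 ≤ 1 / 2 * (N : ℝ) ^ 2 := by nlinarith
  exact le_of_mul_le_mul_right h3 (by positivity)

/-! ### Spanned planes and the ordinary lines in them. -/

section LinesAndPlanes

variable {E : Type*} [AddCommGroup E] [Module ℝ E]

open Classical in
/-- The finite set of planes through three noncollinear points of `P`. -/
noncomputable def planeFinset (P : Finset E) : Finset (AffineSubspace ℝ E) :=
  ((P ×ˢ P ×ˢ P).filter fun x : E × E × E => x.1 ≠ x.2.1 ∧ x.2.2 ∉ line[ℝ, x.1, x.2.1]).image
    fun x => affineSpan ℝ {x.1, x.2.1, x.2.2}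

theorem mem_planeFinset {P : Finset E} {S : AffineSubspace ℝ E} :
    S ∈ planeFinset P ↔ ∃ p ∈ P, ∃ q ∈ P, ∃ r ∈ P, p ≠ q ∧ r ∉ line[ℝ, p, q] ∧
      S = affineSpan ℝ {p, q, r} := by
  classical
  simp only [planeFinset, Finset.mem_image, Finset.mem_filter, Finset.mem_product, Prod.exists]
  constructor
  · rintro ⟨p, q, r, ⟨⟨hp, hq, hr⟩, h1, h2⟩, rfl⟩
    exact ⟨p, hp, q, hq, r, hr, h1, h2, rfl⟩
  · rintro ⟨p, hp, q, hq, r, hr, h1, h2, rfl⟩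
    exact ⟨p, q, r, ⟨⟨hp, hq, hr⟩, h1, h2⟩, rfl⟩

theorem isPlane_of_mem_planeFinset {P : Finset E} {S : AffineSubspace ℝ E}
    (h : S ∈ planeFinset P) : IsPlane S := by
  obtain ⟨p, -, q, -, r, -, h1, h2, rfl⟩ := mem_planeFinset.1 h
  exact isPlane_affineSpan_triple h1 h2

theorem mem_planeFinset_of_isPlane {P : Finset E} {S : AffineSubspace ℝ E} (hS : IsPlane S)
    {p q r : E} (hp : p ∈ P) (hq : q ∈ P) (hr : r ∈ P) (hpS : p ∈ S) (hqS : q ∈ S) (hrS : r ∈ S)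
    (hpq : p ≠ q) (hrl : r ∉ line[ℝ, p, q]) : S ∈ planeFinset P :=
  mem_planeFinset.2 ⟨p, hp, q, hq, r, hr, hpq, hrl, hS.eq_affineSpan_triple hpS hqS hrS hpq hrl⟩

theorem exists_eq_affineSpan_pair_of_mem {P : Finset E} {L : AffineSubspace ℝ E}
    (hL : L ∈ lineFinset P) {p : E} (hp : p ∈ L) : ∃ q ∈ P, q ≠ p ∧ L = line[ℝ, p, q] := by
  have hline := isLine_of_mem_lineFinset hL
  obtain ⟨x, hx, y, hy, hxy, hxyL⟩ := mem_lineFinset.1 hL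
  have hxL : x ∈ L := hxyL ▸ left_mem_affineSpan_pair ..
  have hyL : y ∈ L := hxyL ▸ right_mem_affineSpan_pair ..
  by_cases h : x = p
  · exact ⟨y, hy, fun h' => hxy (h.trans h'.symm), hline.eq_affineSpan_pair hp hyL
      fun h' => hxy (h.trans h')⟩
  · exact ⟨x, hx, h, hline.eq_affineSpan_pair hp hxL (Ne.symm h)⟩

open Classical in
theorem card_lines_through_le (P : Finset E) (p : E) :
    ((lineFinset P).filter (p ∈ ·)).card ≤ P.card := by
  refine (Finset.card_le_card (t := P.image fun q => line[ℝ, p, q]) fun L hL => ?_).trans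
    Finset.card_image_le
  obtain ⟨hL, hp⟩ := Finset.mem_filter.1 hL
  obtain ⟨q, hq, -, rfl⟩ := exists_eq_affineSpan_pair_of_mem hL hp
  exact Finset.mem_image_of_mem _ hq

open Classical in
/-- The planes through a fixed ordinary line contain at most `3 |P|` points of `P`,
counted with multiplicity. -/
theorem sum_card_planes_through_le {P : Finset E} {L : AffineSubspace ℝ E}
    (hL : L ∈ lineFinset P) (h2 : (P.filter (· ∈ L)).card = 2) :
    ∑ S ∈ (planeFinset P).filter (L ≤ ·), (P.filter (· ∈ S)).card ≤ 3 * P.card := by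
  obtain ⟨x, hx, y, hy, hxy, rfl⟩ := mem_lineFinset.1 hL
  set R : AffineSubspace ℝ E → Finset E :=
    fun S => (P.filter (· ∈ S)).filter (· ∉ line[ℝ, x, y]) with hR
  have hle : ∀ S ∈ (planeFinset P).filter (line[ℝ, x, y] ≤ ·),
      (P.filter (· ∈ S)).card ≤ 3 * (R S).card := by
    intro S hS
    obtain ⟨hS, hLS⟩ := Finset.mem_filter.1 hS
    have hsplit := Finset.card_filter_add_card_filter_not (s := P.filter (· ∈ S))
      (fun z => z ∈ line[ℝ, x, y])
    have hon : ((P.filter (· ∈ S)).filter (· ∈ line[ℝ, x, y])).card ≤ 2 := by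
      rw [← h2]
      refine Finset.card_le_card fun z hz => ?_
      simp only [Finset.mem_filter] at hz ⊢
      exact ⟨hz.1.1, hz.2⟩
    -- A spanned plane has a point of `P` off the line, so the two points on the line at most triple
    -- the count. Off the line, distinct planes are disjoint.
    have hpos : 0 < (R S).card := by
      by_contra! h0
      rw [Nat.le_zero, Finset.card_eq_zero, Finset.filter_eq_empty_iff] at h0
      obtain ⟨p, hp, q, hq, r, hr, hpq, hrl, hSe⟩ := mem_planeFinset.1 hS
      have hmem : ∀ z ∈ ({p, q, r} : Set E), z ∈ P → z ∈ line[ℝ, x, y] := fun z hz hzP =>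
        not_not.1 (h0 (Finset.mem_filter.2 ⟨hzP, hSe ▸ mem_affineSpan ℝ hz⟩))
      refine hrl ?_
      rw [← (isLine_affineSpan_pair hxy).eq_affineSpan_pair (hmem p (by simp) hp)
        (hmem q (by simp) hq) hpq]
      exact hmem r (by simp) hr
    change _ + (R S).card = _ at hsplit
    omega
  refine (Finset.sum_le_sum hle).trans ?_
  rw [← Finset.mul_sum, ← Finset.card_biUnion]
  · refine Nat.mul_le_mul_left _ (Finset.card_le_card (Finset.biUnion_subset.2 fun S _ => ?_))
    exact (Finset.filter_subset _ _).trans (Finset.filter_subset _ _)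
  · intro S hS S' hS' hne
    refine Finset.disjoint_left.2 fun z hz hz' => hne ?_
    rw [Finset.mem_coe, Finset.mem_filter] at hS hS'
    simp only [hR, Finset.mem_filter] at hz hz'
    have hxL : x ∈ line[ℝ, x, y] := left_mem_affineSpan_pair ..
    have hyL : y ∈ line[ℝ, x, y] := right_mem_affineSpan_pair ..
    rw [(isPlane_of_mem_planeFinset hS.1).eq_affineSpan_triple (hS.2 hxL) (hS.2 hyL) hz.1.2 hxy
        hz.2,
      (isPlane_of_mem_planeFinset hS'.1).eq_affineSpan_triple (hS'.2 hxL) (hS'.2 hyL) hz'.1.2 hxy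
        hz.2]

open Classical in
-- Sylvester–Gallai is applied to the points of `P` in `S`; the line found lies in `S`, so it meets
-- no further points of `P`.
theorem exists_ordinary_line_le {V : Type*} [NormedAddCommGroup V] [InnerProductSpace ℝ V]
    {P : Finset V} {S : AffineSubspace ℝ V} (hS : S ∈ planeFinset P) :
    ∃ L ∈ lineFinset P, (P.filter (· ∈ L)).card = 2 ∧ L ≤ S := by
  obtain ⟨p, hp, q, hq, r, hr, hpq, hrl, rfl⟩ := mem_planeFinset.1 hS
  set S := affineSpan ℝ {p, q, r}
  have hpS : p ∈ S := mem_affineSpan ℝ (by simp)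
  have hqS : q ∈ S := mem_affineSpan ℝ (by simp)
  have hrS : r ∈ S := mem_affineSpan ℝ (by simp)
  obtain ⟨L, hL, h2⟩ := exists_card_filter_eq_two (P.filter (· ∈ S))
    ⟨_, mem_lineFinset.2 ⟨p, by simp [hp, hpS], q, by simp [hq, hqS], hpq, rfl⟩, r,
      by simp [hr, hrS], hrl⟩
  obtain ⟨x, hx, y, hy, hxy, rfl⟩ := mem_lineFinset.1 hL
  rw [Finset.mem_filter] at hx hy
  have hle : line[ℝ, x, y] ≤ S := affineSpan_pair_le_of_mem_of_mem hx.2 hy.2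
  refine ⟨_, mem_lineFinset.2 ⟨x, hx.1, y, hy.1, hxy, rfl⟩, ?_, hle⟩
  rw [← h2, Finset.filter_filter]
  congr 1
  exact Finset.filter_congr fun z _ => ⟨fun h => ⟨hle h, h⟩, fun h => h.2⟩

open Classical in
theorem sum_card_planeFinset_le {V : Type*} [NormedAddCommGroup V] [InnerProductSpace ℝ V]
    (P : Finset V) : ∑ S ∈ planeFinset P, (P.filter (· ∈ S)).card ≤
      (ordinaryLines P).ncard * (3 * P.card) := by
  have hord : ordinaryLines P = ((lineFinset P).filter fun L => (P.filter (· ∈ L)).card = 2 :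
      Finset (AffineSubspace ℝ V)) := by
    ext L
    rw [Finset.mem_coe, Finset.mem_filter, ← ncard_inter_eq_card_filter]
    exact ⟨fun h => ⟨ordinaryLines_subset_lineFinset P h, h.2⟩,
      fun h => ⟨isLine_of_mem_lineFinset h.1, h.2⟩⟩
  rw [hord, Set.ncard_coe_finset]
  set O := (lineFinset P).filter fun L => (P.filter (· ∈ L)).card = 2
  calc ∑ S ∈ planeFinset P, (P.filter (· ∈ S)).card
      ≤ ∑ S ∈ planeFinset P, ∑ L ∈ O, if L ≤ S then (P.filter (· ∈ S)).card else 0 := by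
        refine Finset.sum_le_sum fun S hS => ?_
        obtain ⟨L, hL, h2, hLS⟩ := exists_ordinary_line_le hS
        refine le_trans (by rw [if_pos hLS]) (Finset.single_le_sum (f := fun L =>
          if L ≤ S then (P.filter (· ∈ S)).card else 0) (fun _ _ => Nat.zero_le _)
          (Finset.mem_filter.2 ⟨hL, h2⟩))
    _ = ∑ L ∈ O, ∑ S ∈ (planeFinset P).filter (L ≤ ·), (P.filter (· ∈ S)).card := by
        rw [Finset.sum_comm]
        simp only [Finset.sum_filter]
    _ ≤ ∑ L ∈ O, 3 * P.card := Finset.sum_le_sum fun L hL =>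
        sum_card_planes_through_le (Finset.mem_filter.1 hL).1 (Finset.mem_filter.1 hL).2
    _ = _ := by rw [Finset.sum_const, smul_eq_mul]

end LinesAndPlanes

/-! ### Parallel and central projections from space to the plane. -/

section Projections

variable {E F : Type*} [AddCommGroup E] [Module ℝ E] [AddCommGroup F] [Module ℝ F]

variable (F) in
-- The projection keeps a coordinate that separates the points of `P`.
theorem exists_surjective_linearMap_injOn [Module.Finite ℝ E] [Module.Finite ℝ F]
    (hE : Module.finrank ℝ E = 3)
    (hF : Module.finrank ℝ F = 2) (P : Finset E) :
    ∃ π : E →ₗ[ℝ] F, Function.Surjective π ∧ Set.InjOn π P := by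
  obtain ⟨e, he⟩ := exists_equiv_prod_injOn (ℝ × ℝ) (by simp [hE]) P
  let e' : (ℝ × ℝ) ≃ₗ[ℝ] F := LinearEquiv.ofFinrankEq _ _ (by simp [hF])
  let π₀ : E →ₗ[ℝ] ℝ × ℝ :=
    (LinearMap.id.prodMap (LinearMap.fst ℝ ℝ ℝ)) ∘ₗ e.toLinearMap
  refine ⟨e'.toLinearMap ∘ₗ π₀, fun v => ?_, fun p hp q hq h => he hp hq ?_⟩
  · refine ⟨e.symm ((e'.symm v).1, ((e'.symm v).2, 0)), ?_⟩
    simp [π₀]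
  · have h' : π₀ p = π₀ q := e'.injective h
    exact congrArg (fun v : ℝ × ℝ => v.1) h'

theorem lineFinset_image_subset [DecidableEq F] [DecidableEq (AffineSubspace ℝ F)]
    (π : E →ₗ[ℝ] F) (P : Finset E) :
    lineFinset (P.image π) ⊆ (lineFinset P).image (AffineSubspace.map π.toAffineMap) := by
  intro L hL
  obtain ⟨x, hx, y, hy, hxy, rfl⟩ := mem_lineFinset.1 hL
  obtain ⟨p, hp, rfl⟩ := Finset.mem_image.1 hx
  obtain ⟨q, hq, rfl⟩ := Finset.mem_image.1 hy
  refine Finset.mem_image.2 ⟨_, mem_lineFinset.2 ⟨p, hp, q, hq, fun h => hxy (h ▸ rfl), rfl⟩, ?_⟩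
  rw [AffineSubspace.map_span, Set.image_pair]
  rfl

/-- Central projection from `p`, in linear coordinates `E ≃ ℝ × F`. -/
noncomputable def centralProj (e : E ≃ₗ[ℝ] ℝ × F) (p x : E) : F :=
  (e (x - p)).1⁻¹ • (e (x - p)).2

/-- Homogenizing the equation `φ v = c` of `l` gives the equation of the cone over `l` with apex
`p`. -/
theorem exists_isPlane_mem_iff_centralProj_mem [Module.Finite ℝ E] [Module.Finite ℝ F]
    (hE : Module.finrank ℝ E = 3)
    (hF : Module.finrank ℝ F = 2) (e : E ≃ₗ[ℝ] ℝ × F) (p : E) {l : AffineSubspace ℝ F}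
    (hl : IsLine l) : ∃ S : AffineSubspace ℝ E, IsPlane S ∧ p ∈ S ∧
      ∀ x, (e (x - p)).1 ≠ 0 → (x ∈ S ↔ centralProj e p x ∈ l) := by
  obtain ⟨φ, c, hφ, hl⟩ := hl.exists_equation hF
  let ψ : E →ₗ[ℝ] ℝ := (φ ∘ₗ LinearMap.snd ℝ ℝ F - c • LinearMap.fst ℝ ℝ F) ∘ₗ e.toLinearMap
  have hψ : ∀ x, ψ x = φ (e x).2 - c * (e x).1 := fun x => by simp [ψ]
  have hψ0 : ψ ≠ 0 := by
    intro h0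
    refine hφ (LinearMap.ext fun v => ?_)
    have := hψ (e.symm (0, v))
    rw [h0] at this
    simpa using this.symm
  obtain ⟨S, hS, hmem⟩ := exists_isPlane_of_equation hE hψ0 (ψ p)
  refine ⟨S, hS, (hmem p).2 rfl, fun x hx => ?_⟩
  rw [hmem, hl, centralProj, map_smul, smul_eq_mul, ← sub_eq_zero, ← map_sub, hψ,
    inv_mul_eq_iff_eq_mul₀ hx, sub_eq_zero, mul_comm c]

theorem centralProj_eq_of_mem (e : E ≃ₗ[ℝ] ℝ × F) {p q x : E} (hx : x ∈ line[ℝ, p, q])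
    (hx0 : (e (x - p)).1 ≠ 0) : centralProj e p x = centralProj e p q := by
  obtain ⟨t, rfl⟩ := mem_affineSpan_pair_iff_exists_lineMap_eq.1 hx
  rw [AffineMap.lineMap_apply, vsub_eq_sub, vadd_eq_add, add_sub_cancel_right, map_smul] at hx0
  rw [centralProj, centralProj, AffineMap.lineMap_apply, vsub_eq_sub, vadd_eq_add,
    add_sub_cancel_right, map_smul]
  have ht : t ≠ 0 := fun h => hx0 (by simp [h])
  rw [Prod.smul_fst, Prod.smul_snd, smul_smul, smul_eq_mul, mul_inv, mul_right_comm,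
    inv_mul_cancel₀ ht, one_mul]

theorem affineSpan_pair_eq_of_centralProj_eq (e : E ≃ₗ[ℝ] ℝ × F) {p q q' : E}
    (hq : (e (q - p)).1 ≠ 0) (hq' : (e (q' - p)).1 ≠ 0)
    (h : centralProj e p q = centralProj e p q') : line[ℝ, p, q] = line[ℝ, p, q'] := by
  have hne : p ≠ q' := fun h0 => hq' (by simp [h0])
  have hne' : p ≠ q := fun h0 => hq (by simp [h0])
  refine ((isLine_affineSpan_pair hne').eq_affineSpan_pair (left_mem_affineSpan_pair ..) ?_ hne)
  rw [mem_affineSpan_pair_iff_exists_lineMap_eq]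
  refine ⟨(e (q' - p)).1 * (e (q - p)).1⁻¹, ?_⟩
  rw [AffineMap.lineMap_apply, vsub_eq_sub, vadd_eq_add, ← eq_sub_iff_add_eq]
  refine e.injective (Prod.ext ?_ ?_)
  · rw [map_smul, Prod.smul_fst, smul_eq_mul, inv_mul_cancel_right₀ hq]
  · rw [map_smul, Prod.smul_snd, mul_smul]
    change (e (q' - p)).1 • centralProj e p q = _
    rw [h, centralProj, smul_inv_smul₀ hq']

open Classical in
theorem card_lines_through_le_card_image_centralProj [DecidableEq E] [DecidableEq F]
    (e : E ≃ₗ[ℝ] ℝ × F) {P : Finset E} {p : E}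
    (h0 : ∀ q ∈ P.erase p, (e (q - p)).1 ≠ 0) :
    ((lineFinset P).filter (p ∈ ·)).card ≤ ((P.erase p).image (centralProj e p)).card := by
  have hex : ∀ L ∈ (lineFinset P).filter (p ∈ ·), ∃ q ∈ P.erase p, L = line[ℝ, p, q] := by
    intro L hL
    obtain ⟨hL, hp⟩ := Finset.mem_filter.1 hL
    obtain ⟨q, hq, hqp, rfl⟩ := exists_eq_affineSpan_pair_of_mem hL hp
    exact ⟨q, Finset.mem_erase.2 ⟨hqp, hq⟩, rfl⟩
  choose! g hg hgL using hex
  refine Finset.card_le_card_of_injOn (fun L => centralProj e p (g L))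
    (fun L hL => Finset.mem_image_of_mem _ (hg L hL)) fun L hL L' hL' h => ?_
  rw [hgL L hL, hgL L' hL']
  exact affineSpan_pair_eq_of_centralProj_eq e (h0 _ (hg L hL)) (h0 _ (hg L' hL')) h

open Classical in
-- Two distinct image points on `l` come from points not collinear with `p`, so the cone over `l` is
-- a spanned plane. The cone determines `l` through these two image points.
theorem card_lineFinset_image_centralProj_le [DecidableEq E] [DecidableEq F]
    [Module.Finite ℝ E] [Module.Finite ℝ F] (hE : Module.finrank ℝ E = 3)
    (hF : Module.finrank ℝ F = 2) (e : E ≃ₗ[ℝ] ℝ × F) {P : Finset E} {p : E} (hp : p ∈ P)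
    (h0 : ∀ q ∈ P.erase p, (e (q - p)).1 ≠ 0) :
    (lineFinset ((P.erase p).image (centralProj e p))).card ≤
      ((planeFinset P).filter (p ∈ ·)).card := by
  set Q := (P.erase p).image (centralProj e p)
  have hex : ∀ l ∈ lineFinset Q, ∃ S : AffineSubspace ℝ E, IsPlane S ∧ p ∈ S ∧
      ∀ x, (e (x - p)).1 ≠ 0 → (x ∈ S ↔ centralProj e p x ∈ l) := fun l hl =>
    exists_isPlane_mem_iff_centralProj_mem hE hF e p (isLine_of_mem_lineFinset hl)
  choose! g hgS hgp hg using hex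
  refine Finset.card_le_card_of_injOn g (fun l hl => ?_) fun l hl l' hl' h => ?_
  · obtain ⟨x, hx, y, hy, hxy, hxyl⟩ := mem_lineFinset.1 hl
    obtain ⟨s, hs, rfl⟩ := Finset.mem_image.1 hx
    obtain ⟨t, ht, rfl⟩ := Finset.mem_image.1 hy
    refine Finset.mem_filter.2 ⟨?_, hgp l hl⟩
    refine mem_planeFinset_of_isPlane (hgS l hl) hp (Finset.mem_of_mem_erase hs)
      (Finset.mem_of_mem_erase ht) (hgp l hl) ?_ ?_ (Finset.ne_of_mem_erase hs).symm
      fun htl => hxy (centralProj_eq_of_mem e htl (h0 t ht)).symm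
    · rw [hg l hl s (h0 s hs), hxyl]
      exact left_mem_affineSpan_pair ..
    · rw [hg l hl t (h0 t ht), hxyl]
      exact right_mem_affineSpan_pair ..
  · obtain ⟨x, hx, y, hy, hxy, hxyl⟩ := mem_lineFinset.1 hl
    obtain ⟨s, hs, rfl⟩ := Finset.mem_image.1 hx
    obtain ⟨t, ht, rfl⟩ := Finset.mem_image.1 hy
    have hsl : centralProj e p s ∈ l := hxyl ▸ left_mem_affineSpan_pair ..
    have htl : centralProj e p t ∈ l := hxyl ▸ right_mem_affineSpan_pair ..
    refine (isLine_of_mem_lineFinset hl).eq_of_mem (isLine_of_mem_lineFinset hl') hxy hsl htl ?_ ?_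
    · rwa [← hg l' hl' s (h0 s hs), ← h, hg l hl s (h0 s hs)]
    · rwa [← hg l' hl' t (h0 t ht), ← h, hg l hl t (h0 t ht)]

end Projections

/-! ### The counting argument in space. -/

section Space

variable {β γ : ℝ} {P : Finset (EuclideanSpace ℝ (Fin 3))}

open Classical in
theorem IsBeckPair.le_card_lineFinset (h : IsBeckPair β γ)
    (hP : ∀ S : AffineSubspace ℝ (EuclideanSpace ℝ (Fin 3)), IsPlane S →
      ((P.filter (· ∈ S)).card : ℝ) ≤ β * γ * P.card) :
    γ * (P.card : ℝ) ^ 2 ≤ (lineFinset P).card := by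
  have hγ := h.le_half
  obtain ⟨hβ, hγ0, hB⟩ := h
  have hE : Module.finrank ℝ (EuclideanSpace ℝ (Fin 3)) = 3 := by simp
  have hF : Module.finrank ℝ (EuclideanSpace ℝ (Fin 2)) = 2 := by simp
  obtain ⟨π, hsurj, hinj⟩ := exists_surjective_linearMap_injOn (EuclideanSpace ℝ (Fin 2)) hE hF P
  have hcard : (P.image π).card = P.card := Finset.card_image_of_injOn hinj
  have h1 := hB (P.image π) fun L hL => by
    obtain ⟨φ, c, hφ, hmem⟩ := hL.exists_equation hF
    have hφ0 : φ ∘ₗ π ≠ 0 := fun h0 => hφ (LinearMap.ext fun v => by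
      obtain ⟨x, rfl⟩ := hsurj v
      exact LinearMap.congr_fun h0 x)
    obtain ⟨S, hS, hSmem⟩ := exists_isPlane_of_equation hE hφ0 c
    rw [ncard_inter_eq_card_filter, hcard, Finset.filter_image]
    have h2 : (P.filter fun x => π x ∈ L) = P.filter (· ∈ S) := Finset.filter_congr fun x _ => by
      rw [hmem, hSmem]; rfl
    rw [h2]
    refine (Nat.cast_le.2 Finset.card_image_le).trans ((hP S hS).trans ?_)
    have : β * γ ≤ β := by nlinarith
    gcongr
  rw [ncard_spannedLines, hcard] at h1
  refine h1.trans (Nat.cast_le.2 ?_)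
  exact (Finset.card_le_card (lineFinset_image_subset π P)).trans Finset.card_image_le

open Classical in
theorem IsBeckPair.le_card_planes_through (h : IsBeckPair β γ)
    (hP : ∀ S : AffineSubspace ℝ (EuclideanSpace ℝ (Fin 3)), IsPlane S →
      ((P.filter (· ∈ S)).card : ℝ) ≤ β * γ * P.card)
    {p : EuclideanSpace ℝ (Fin 3)} (hp : p ∈ P)
    (hlines : γ * P.card ≤ (((lineFinset P).filter (p ∈ ·)).card : ℝ)) :
    γ ^ 3 * (P.card : ℝ) ^ 2 ≤ ((planeFinset P).filter (p ∈ ·)).card := by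
  obtain ⟨hβ, hγ0, hB⟩ := h
  have hE : Module.finrank ℝ (EuclideanSpace ℝ (Fin 3)) = 3 := by simp
  have hF : Module.finrank ℝ (EuclideanSpace ℝ (Fin 2)) = 2 := by simp
  obtain ⟨e, he⟩ := exists_equiv_prod_injOn (EuclideanSpace ℝ (Fin 2)) (by simp) P
  have h0 : ∀ q ∈ P.erase p, (e (q - p)).1 ≠ 0 := by
    intro q hq h0
    rw [map_sub, Prod.fst_sub, sub_eq_zero] at h0
    exact Finset.ne_of_mem_erase hq (he (Finset.mem_of_mem_erase hq) hp h0)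
  set Q := (P.erase p).image (centralProj e p) with hQ
  have hm : γ * P.card ≤ (Q.card : ℝ) := hlines.trans
    (Nat.cast_le.2 (card_lines_through_le_card_image_centralProj e h0))
  have h1 := hB Q fun l hl => by
    obtain ⟨S, hS, -, hmem⟩ := exists_isPlane_mem_iff_centralProj_mem hE hF e p hl
    rw [ncard_inter_eq_card_filter, hQ, Finset.filter_image, ← hQ]
    have h2 : ((P.erase p).filter fun x => centralProj e p x ∈ l) ⊆ P.filter (· ∈ S) := by
      intro x hx
      obtain ⟨hxP, hxl⟩ := Finset.mem_filter.1 hx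
      exact Finset.mem_filter.2 ⟨Finset.mem_of_mem_erase hxP, (hmem x (h0 x hxP)).2 hxl⟩
    calc _ ≤ ((P.filter (· ∈ S)).card : ℝ) :=
          Nat.cast_le.2 (Finset.card_image_le.trans (Finset.card_le_card h2))
      -- This is where the factor `γ` in `β * γ` is needed: only `γ |P|` image points are
      -- guaranteed.
      _ ≤ β * (γ * P.card) := by rw [← mul_assoc]; exact hP S hS
      _ ≤ _ := by gcongr
  rw [ncard_spannedLines] at h1
  calc γ ^ 3 * (P.card : ℝ) ^ 2 = γ * (γ * P.card) ^ 2 := by ring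
    _ ≤ γ * (Q.card : ℝ) ^ 2 := by gcongr
    _ ≤ _ := h1.trans (Nat.cast_le.2 (card_lineFinset_image_centralProj_le hE hF e hp h0))

open Classical in
theorem IsBeckPair.le_sum_card_planeFinset (h : IsBeckPair β γ)
    (hP : ∀ S : AffineSubspace ℝ (EuclideanSpace ℝ (Fin 3)), IsPlane S →
      ((P.filter (· ∈ S)).card : ℝ) ≤ β * γ * P.card) :
    γ ^ 4 * (P.card : ℝ) ^ 3 ≤ ((∑ S ∈ planeFinset P, (P.filter (· ∈ S)).card : ℕ) : ℝ) := by
  have hlines := h.le_card_lineFinset hP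
  have hγ0 : 0 < γ := h.2.1
  rcases P.eq_empty_or_nonempty with rfl | hne
  · simp
  have hn : (0 : ℝ) < P.card := by exact_mod_cast hne.card_pos
  set m : EuclideanSpace ℝ (Fin 3) → ℕ := fun p => ((lineFinset P).filter (p ∈ ·)).card with hm
  set G := P.filter fun p => γ * P.card ≤ (m p : ℝ) with hG
  have hsum : 2 * (lineFinset P).card ≤ ∑ p ∈ P, m p := by
    have h1 : ∑ p ∈ P, m p = ∑ L ∈ lineFinset P, (P.filter (· ∈ L)).card :=
      Finset.sum_card_bipartiteAbove_eq_sum_card_bipartiteBelow (fun p L => p ∈ L)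
    rw [h1, mul_comm]
    refine Finset.card_nsmul_le_sum _ _ 2 fun L hL => ?_
    rw [← ncard_inter_eq_card_filter]
    have hL' : L ∈ spannedLines P := by rw [← coe_lineFinset]; exact hL
    exact hL'.2
  have hsum' : ((∑ p ∈ P, m p : ℕ) : ℝ) ≤ G.card * P.card + P.card * (γ * P.card) := by
    rw [Nat.cast_sum, ← Finset.sum_filter_add_sum_filter_not P fun p => γ * P.card ≤ (m p : ℝ)]
    refine add_le_add ?_ ?_
    · rw [← nsmul_eq_mul]
      exact Finset.sum_le_card_nsmul _ _ _ fun p _ => Nat.cast_le.2 (card_lines_through_le P p)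
    · refine (Finset.sum_le_card_nsmul _ _ (γ * P.card) fun p hp =>
        (not_le.1 (Finset.mem_filter.1 hp).2).le).trans ?_
      rw [nsmul_eq_mul]
      gcongr
      exact Finset.filter_subset _ _
  -- Of the at least `2 γ |P|²` incidences, points outside `G` carry at most `γ |P|²`, and each
  -- point of `G` at most `|P|`.
  have hGcard : γ * P.card ≤ G.card := by
    have h1 : (2 : ℝ) * (lineFinset P).card ≤ ((∑ p ∈ P, m p : ℕ) : ℝ) := by exact_mod_cast hsum
    have h2 : γ * P.card * P.card ≤ G.card * P.card := by nlinarith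
    exact le_of_mul_le_mul_right h2 hn
  have hswap : ∑ S ∈ planeFinset P, (P.filter (· ∈ S)).card =
      ∑ p ∈ P, ((planeFinset P).filter (p ∈ ·)).card :=
    (Finset.sum_card_bipartiteAbove_eq_sum_card_bipartiteBelow (fun p S => p ∈ S)).symm
  rw [hswap, Nat.cast_sum]
  calc γ ^ 4 * (P.card : ℝ) ^ 3 = γ * P.card * (γ ^ 3 * (P.card : ℝ) ^ 2) := by ring
    _ ≤ G.card * (γ ^ 3 * (P.card : ℝ) ^ 2) := by gcongr
    _ ≤ ∑ p ∈ G, (((planeFinset P).filter (p ∈ ·)).card : ℝ) := by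
        rw [← nsmul_eq_mul]
        refine Finset.card_nsmul_le_sum _ _ _ fun p hp => ?_
        obtain ⟨hpP, hpl⟩ := Finset.mem_filter.1 hp
        exact h.le_card_planes_through hP hpP hpl
    _ ≤ _ := Finset.sum_le_sum_of_subset_of_nonneg (Finset.filter_subset _ _)
        fun _ _ _ => Nat.cast_nonneg _

theorem IsBeckPair.fewCoplanarBound (h : IsBeckPair β γ) :
    FewCoplanarBound (β * γ) (γ ^ 5 / 2) := by
  classical
  intro P hP
  simp only [ncard_inter_eq_card_filter] at hP
  rcases P.eq_empty_or_nonempty with rfl | hne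
  · simp
  have hn : (0 : ℝ) < P.card := by exact_mod_cast hne.card_pos
  have h1 := h.le_sum_card_planeFinset hP
  have h2 : ((∑ S ∈ planeFinset P, (P.filter (· ∈ S)).card : ℕ) : ℝ) ≤
      (ordinaryLines P).ncard * (3 * P.card) := by exact_mod_cast sum_card_planeFinset_le P
  have h3 : γ ^ 4 * (P.card : ℝ) ^ 2 ≤ 3 * (ordinaryLines P).ncard := by
    refine le_of_mul_le_mul_right ?_ hn
    linarith
  -- Hence `γ⁵ / 2 ≤ γ⁴ / 4`, which is below the available `γ⁴ / 3`.
  have h4 : γ ^ 5 ≤ γ ^ 4 * (1 / 2) := by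
    rw [pow_succ γ 4]
    exact mul_le_mul_of_nonneg_left h.le_half (pow_nonneg h.2.1.le 4)
  have h5 := mul_le_mul_of_nonneg_right h4 (sq_nonneg (P.card : ℝ))
  have h6 : (0 : ℝ) ≤ (ordinaryLines P).ncard := Nat.cast_nonneg _
  linarith

end Space

theorem proposition3p1 :
    (∃ α₀ : ℝ, 0 < α₀ ∧ ∃ c : ℝ, 0 < c ∧ FewCoplanarBound α₀ c) ∧
    (∃ β γ : ℝ, IsBeckPair β γ) ∧
    (∀ β γ : ℝ, IsBeckPair β γ → FewCoplanarBound (β * γ) (γ ^ 5 / 2)) :=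
  have h := isBeckPair_explicit
  ⟨⟨_, mul_pos h.1 h.2.1, _, half_pos (pow_pos h.2.1 5), h.fewCoplanarBound⟩, ⟨_, _, h⟩,
    fun _ _ h => h.fewCoplanarBound⟩
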